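/- **Setting.** Let $n\ge 1$, let $\mathcal H_0,\dots,\mathcal H_{n-1}$ be real Hilbert spaces and $\mathcal H_n:=\mathcal H_0$. Consider the problem of finding $z\in\mathcal H_0$ with $$0\in\sum_{i=1}^n G_i^*T_i(G_iz),\qquad T_i:=A_i+B_i+C_i+D_i, \tag{P}$$ and assume, for $i=1,\dots,n$ (with the conventions $1/\infty=0$, $1/0=\infty$, $0\cdot\infty=0$, $r\cdot\infty=\infty$ for $r>0$): * (A1) $G_i:\mathcal H_0\to\mathcal H_i$ is bounded linear and $G_n=I$. * (A2) $A_i:\mathcal H_i\rightrightarrows\mathcal H_i$ is maximal monotone. * (A3) $B_i:\mathcal H_i\to\mathcal H_i$ is monotone and $\ell_i$-Lipschitz continuous, $\ell_i\in[0,\infty)$. * (A4) $C_i:\mathcal H_i\to\mathcal H_i$ is $\beta_i$-cocoercive, $\beta_i\in(0,\infty]$: $\langle x-y,C_i(x)-C_i(y)\rangle\ge\beta_i\|C_i(x)-C_i(y)\|^2$ for all $x,y\in\mathcal H_i$. * (A5) $D_i:\mathcal H_i\to\mathcal H_i$ is monotone and continuously differentiable, and $D_i'$ is $m_i$-Lipschitz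 continuous in the operator norm, $m_i\in[0,\infty)$. * (A6) Problem (P) has a solution. * (A7) There is $\mathcal I_{\mathcal D}\subset\{1,\dots,n\}$ such that $m_i>0$ for $i\in\mathcal I_{\mathcal D}$, and $m_i=0$ and $D_i=0$ for $i\notin\mathcal I_{\mathcal D}$. Write $D_{i(u)}(x):=D_i(u)+D_i'(u)(x-u)$ and $J_T:=(T+I)^{-1}$. For $\gamma>0$, let $\boldsymbol{\mathcal H}:=\mathcal H_0\times\mathcal H_1\times\dots\times\mathcal H_{n-1}$ carry the inner product $\langle (z,w),(z',w')\rangle_\gamma=\gamma\langle z,z'\rangle+\sum_{i=1}^{n-1}\langle w_i,w_i'\rangle$. The extended solution set is $$\mathcal S:=\Big\{(z,w_1,\dots,w_{n-1})\in\boldsymbol{\mathcal H}\;\Big|\; w_i\in T_i(G_iz),\ i=1,\dots,n,\ \text{ where } w_n:=-\sum_{i=1}^{n-1}G_i^*w_i\Big\}.$$ **Algorithm.** The input is $(z^0,w_1^0,\dots,w_{n-1}^0)\in\boldsymbol{\mathcal H}$, $0<\underline\tau<\overline\tau<2$, $0<\underline\theta<\overline\theta<2$, and $\hat\rho,\hat\delta,\gamma>0$;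 set $w_n^0:=-\sum_{i=1}^{n-1}G_i^*w_i^0$. For $k=0,1,2,\dots$: 1. For each $i=1,\dots,n$: * If $w_i^k\in T_i(G_iz^k)$, set $\rho_i^k=\hat\rho$, $x_i^k=G_iz^k$, $y_i^k=w_i^k$. * Otherwise, if $i\in\mathcal I_{\mathcal D}$, take $\rho_i^k>0$, $x_i^k$, $y_i^k$ (for instance by a line search on $\rho_i^k$) such that $$x_i^k=J_{\rho_i^k(A_i+D_{i(G_iz^k)})}\big(G_iz^k+\rho_i^kw_i^k-\rho_i^k(B_i+C_i)(G_iz^k)\big),$$ $$y_i^k=\frac{G_iz^k-x_i^k}{\rho_i^k}+w_i^k+\big[B_i(x_i^k)-B_i(G_iz^k)\big]+\big[D_i(x_i^k)-D_{i(G_iz^k)}(x_i^k)\big],$$ $$\underline\theta\le 4\ell_i^2(\rho_i^k)^2+(\beta_i^{-1}+\hat\delta)\rho_i^k+\big(m_i\rho_i^k\|x_i^k-G_iz^k\|\big)^2\le\overline\theta.$$ * Otherwise, if $i\notin\mathcal I_{\mathcal D}$, choose $\rho_i^k>0$ and set $$x_i^k=J_{\rho_i^kA_i}\big(G_iz^k+\rho_i^kw_i^k-\rho_i^k(B_i+C_i)(G_iz^k)\big),\qquad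 y_i^k=\frac{G_iz^k-x_i^k}{\rho_i^k}+w_i^k+\big[B_i(x_i^k)-B_i(G_iz^k)\big].$$ 2. Set $u_i^k=x_i^k-G_ix_n^k$ for $i=1,\dots,n$, $v^k=\sum_{i=1}^{n-1}G_i^*y_i^k+y_n^k$, $$\varphi_k=\langle z^k,v^k\rangle+\sum_{i=1}^{n-1}\langle w_i^k,u_i^k\rangle-\sum_{i=1}^n\Big[\langle x_i^k,y_i^k\rangle+\tfrac1{4\beta_i}\|x_i^k-G_iz^k\|^2\Big],\qquad \pi_k=\gamma^{-1}\|v^k\|^2+\sum_{i=1}^{n-1}\|u_i^k\|^2.$$ 3. If $\varphi_k>0$, choose $\tau_k\in[\underline\tau,\overline\tau]$, set $\alpha_k=\tau_k\varphi_k/\pi_k$, $z^{k+1}=z^k-\gamma^{-1}\alpha_kv^k$ and $w_i^{k+1}=w_i^k-\alpha_ku_i^k$ for $i=1,\dots,n-1$. Otherwise set $z^{k+1}=z^k$ and $w_i^{k+1}=w_i^k$ for $i=1,\dots,n-1$. In both cases set $w_n^{k+1}=-\sum_{i=1}^{n-1}G_i^*w_i^{k+1}$. Assume finally: * (A8) For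 every $i\notin\mathcal I_{\mathcal D}$ there are $\underline\rho_i,\overline\rho_i$ such that the parameters $\rho_i^k$ chosen in the third case of step 1 satisfy $$0<\underline\rho_i\le\rho_i^k\le\overline\rho_i<\frac{1}{\frac1{4\beta_i}+\ell_i}.$$ **Theorem.** Under (A1)–(A8), for any sequences generated by the algorithm, $p^k:=(z^k,w_1^k,\dots,w_{n-1}^k)$ converges weakly in $(\boldsymbol{\mathcal H},\langle\cdot,\cdot\rangle_\gamma)$ to some $\bar p=(\bar z,\bar w_1,\dots,\bar w_{n-1})\in\mathcal S$. That is, with $\bar w_n:=-\sum_{i=1}^{n-1}G_i^*\bar w_i$, $$z^k\rightharpoonup\bar z,\qquad w_i^k\rightharpoonup\bar w_i\quad\text{and}\quad \bar w_i\in T_i(G_i\bar z)\qquad(i=1,\dots,n);$$ in particular $\bar z$ solves (P). Moreover, $x_i^k\rightharpoonup G_i\bar z$ and $y_i^k\rightharpoonup\bar w_i$ for $i=1,\dots,n$. -/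

import Mathlib

open Filter Topology
open scoped Pointwise ENNReal NNReal

noncomputable section

namespace ProjSplit

section SingleSpace

variable {E : Type*} [NormedAddCommGroup E] [InnerProductSpace ℝ E]

/-- A set-valued operator `T : E ⇉ E` is monotone. -/
def IsMonotoneOp (T : E → Set E) : Prop :=
  ∀ ⦃z z' v v' : E⦄, v ∈ T z → v' ∈ T z' → 0 ≤ inner ℝ (z - z') (v - v')

/-- `T` is maximal monotone: monotone, and its graph is not properly contained in the graph of
another monotone operator. -/
def IsMaximalMonotone (T : E → Set E) : Prop :=
  IsMonotoneOp T ∧ ∀ S : E → Set E, IsMonotoneOp S → (∀ z, T z ⊆ S z) → S = T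

/-- Monotonicity of a point-to-point operator. -/
def IsMonotoneMap (F : E → E) : Prop :=
  ∀ x y : E, 0 ≤ inner ℝ (x - y) (F x - F y)

/-- `β`-cocoercivity with `β ∈ (0, ∞]`: `⟨x - y, C x - C y⟩ ≥ β ‖C x - C y‖²`, read in the extended
reals with `0 · ∞ = 0` and `r · ∞ = ∞` for `r > 0` (so for `β = ∞` the map is constant). -/
def IsCocoercive (β : ℝ≥0∞) (C : E → E) : Prop :=
  ∀ x y : E, (β : EReal) * ((‖C x - C y‖ ^ 2 : ℝ) : EReal)
    ≤ ((inner ℝ (x - y) (C x - C y) : ℝ) : EReal)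

/-- The linearization `D_(u)(x) = D(u) + D'(u)(x - u)`. -/
def linearization (D : E → E) (u x : E) : E :=
  D u + fderiv ℝ D u (x - u)

/-- The resolvent `J_T = (T + I)⁻¹` as a set-valued operator:
`x ∈ J_T(s)` iff `s ∈ T(x) + x`. -/
def resolventOp (T : E → Set E) (s : E) : Set E :=
  {x | s ∈ T x + {x}}

/-- Weak convergence of a sequence, through the weak topology of `E`. -/
def WeakTendsto (x : ℕ → E) (l : E) : Prop :=
  Tendsto (fun k => toWeakSpace ℝ E (x k)) atTop (𝓝 (toWeakSpace ℝ E l))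

end SingleSpace

/-- Data of the inclusion `0 ∈ ∑_{i=1}^n G_i^* (A_i + B_i + C_i + D_i) G_i z`, with `n = m + 1`.
The indices `1, …, n` are the elements of `Fin (m + 1)`; the index `n` is `Fin.last m`, and
`1, …, n - 1` are the `i.castSucc` with `i : Fin m`. The Hilbert spaces are `H_1, …, H_n`, and
`H_0` is `H_n = H (Fin.last m)`. The moduli are `ℓ_i, m_i ∈ [0, ∞)` and `β_i ∈ [0, ∞]`. -/
structure Problem {m : ℕ} (H : Fin (m + 1) → Type*)
    [∀ i, NormedAddCommGroup (H i)] [∀ i, InnerProductSpace ℝ (H i)] where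
  G : ∀ i, H (Fin.last m) →L[ℝ] H i
  A : ∀ i, H i → Set (H i)
  B : ∀ i, H i → H i
  C : ∀ i, H i → H i
  D : ∀ i, H i → H i
  lipB : Fin (m + 1) → ℝ≥0
  β : Fin (m + 1) → ℝ≥0∞
  lipD : Fin (m + 1) → ℝ≥0
  ID : Set (Fin (m + 1))

/-- The product space `H_0 × H_1 × ⋯ × H_{n-1}`. -/
abbrev ProductSpace {m : ℕ} (H : Fin (m + 1) → Type*) : Type _ :=
  H (Fin.last m) × (∀ i : Fin m, H i.castSucc)

/-- The inner product `⟨p, p'⟩_γ = γ ⟨z, z'⟩ + ∑_{i=1}^{n-1} ⟨w_i, w'_i⟩`. -/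
def gammaInner {m : ℕ} {H : Fin (m + 1) → Type*}
    [∀ i, NormedAddCommGroup (H i)] [∀ i, InnerProductSpace ℝ (H i)]
    (γ : ℝ) (p p' : ProductSpace H) : ℝ :=
  γ * inner ℝ p.1 p'.1 + ∑ i : Fin m, inner ℝ (p.2 i) (p'.2 i)

/-- Weak convergence of a sequence in the Hilbert space `(H_0 × ⋯ × H_{n-1}, ⟨·,·⟩_γ)`. -/
def GammaWeakTendsto {m : ℕ} {H : Fin (m + 1) → Type*}
    [∀ i, NormedAddCommGroup (H i)] [∀ i, InnerProductSpace ℝ (H i)]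
    (γ : ℝ) (p : ℕ → ProductSpace H) (l : ProductSpace H) : Prop :=
  ∀ q : ProductSpace H, Tendsto (fun k => gammaInner γ q (p k)) atTop (𝓝 (gammaInner γ q l))

namespace Problem

variable {m : ℕ} {H : Fin (m + 1) → Type*}
  [∀ i, NormedAddCommGroup (H i)] [∀ i, InnerProductSpace ℝ (H i)]

/-- `T_i = A_i + B_i + C_i + D_i`. -/
def T (P : Problem H) (i : Fin (m + 1)) (x : H i) : Set (H i) :=
  P.A i x + {P.B i x + P.C i x + P.D i x}

/-- The real number `1 / (4 β_i)`, with `1 / ∞ = 0`. -/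
def quarterInvBeta (P : Problem H) (i : Fin (m + 1)) : ℝ :=
  ((4 * P.β i)⁻¹).toReal

variable [∀ i, CompleteSpace (H i)]

/-- The set `∑_{i=1}^n G_i^* T_i(G_i z)` (Minkowski sum). -/
def compositeOp (P : Problem H) (z : H (Fin.last m)) : Set (H (Fin.last m)) :=
  ∑ i, (ContinuousLinearMap.adjoint (P.G i)) '' P.T i (P.G i z)

/-- `w_n = - ∑_{i=1}^{n-1} G_i^* w_i`. -/
def lastDual (P : Problem H) (w : ∀ i : Fin m, H i.castSucc) : H (Fin.last m) :=
  -∑ i : Fin m, ContinuousLinearMap.adjoint (P.G i.castSucc) (w i)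

/-- The tuple `(w_1, …, w_{n-1}, w_n)` with `w_n = - ∑_{i=1}^{n-1} G_i^* w_i`. -/
def extendDual (P : Problem H) (w : ∀ i : Fin m, H i.castSucc) (i : Fin (m + 1)) : H i :=
  Fin.snoc (α := H) w (P.lastDual w) i

/-- The extended solution set. -/
def extendedSolutionSet (P : Problem H) : Set (ProductSpace H) :=
  {p | ∀ i, P.extendDual p.2 i ∈ P.T i (P.G i p.1)}

end Problem

/-- The scalar inputs of the algorithm. -/
structure Params where
  τlo : ℝ
  τhi : ℝ
  θlo : ℝ
  θhi : ℝ
  ρhat : ℝ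
  δhat : ℝ
  γ : ℝ

/-- `0 < τlo < τhi < 2`, `0 < θlo < θhi < 2` and `ρhat, δhat, γ > 0`. -/
structure Params.Admissible (q : Params) : Prop where
  τlo_pos : 0 < q.τlo
  τlo_lt : q.τlo < q.τhi
  τhi_lt : q.τhi < 2
  θlo_pos : 0 < q.θlo
  θlo_lt : q.θlo < q.θhi
  θhi_lt : q.θhi < 2
  ρhat_pos : 0 < q.ρhat
  δhat_pos : 0 < q.δhat
  γ_pos : 0 < q.γ

/-- The sequences `z^k`, `w_i^k`, `x_i^k`, `y_i^k`, `ρ_i^k` (`i = 1, …, n`) and `τ_k`. -/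
structure Iterates {m : ℕ} (H : Fin (m + 1) → Type*) where
  z : ℕ → H (Fin.last m)
  w : ℕ → ∀ i, H i
  x : ℕ → ∀ i, H i
  y : ℕ → ∀ i, H i
  ρ : ℕ → Fin (m + 1) → ℝ
  τ : ℕ → ℝ

/-- The iterate `p^k = (z^k, w_1^k, …, w_{n-1}^k)`. -/
def Iterates.point {m : ℕ} {H : Fin (m + 1) → Type*} (s : Iterates H) (k : ℕ) :
    ProductSpace H :=
  (s.z k, fun i => s.w k i.castSucc)

section Algorithm

variable {m : ℕ} {H : Fin (m + 1) → Type*}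
  [∀ i, NormedAddCommGroup (H i)] [∀ i, InnerProductSpace ℝ (H i)]

/-- The argument `G_i z^k + ρ_i^k w_i^k - ρ_i^k (B_i + C_i)(G_i z^k)` of the resolvents. -/
def forwardPoint (P : Problem H) (s : Iterates H) (k : ℕ) (i : Fin (m + 1)) : H i :=
  P.G i (s.z k) + s.ρ k i • s.w k i
    - s.ρ k i • (P.B i (P.G i (s.z k)) + P.C i (P.G i (s.z k)))

/-- The proximal-Newton step (for `i ∈ I_D`): the triple `(ρ_i^k, x_i^k, y_i^k)` returned by the
line search. -/
def NewtonStep (P : Problem H) (q : Params) (s : Iterates H) (k : ℕ) (i : Fin (m + 1)) : Prop :=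
  0 < s.ρ k i ∧
  s.x k i ∈ resolventOp
    (s.ρ k i • fun a : H i => P.A i a + {linearization (P.D i) (P.G i (s.z k)) a})
    (forwardPoint P s k i) ∧
  s.y k i = (s.ρ k i)⁻¹ • (P.G i (s.z k) - s.x k i) + s.w k i
    + (P.B i (s.x k i) - P.B i (P.G i (s.z k)))
    + (P.D i (s.x k i) - linearization (P.D i) (P.G i (s.z k)) (s.x k i)) ∧
  4 * (P.lipB i : ℝ) ^ 2 * (s.ρ k i) ^ 2 + (((P.β i)⁻¹).toReal + q.δhat) * s.ρ k i
    + ((P.lipD i : ℝ) * s.ρ k i * ‖s.x k i - P.G i (s.z k)‖) ^ 2 ∈ Set.Icc q.θlo q.θhi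

/-- The backward, half-forward step (for `i ∉ I_D`), with a freely chosen `ρ_i^k > 0`. -/
def HalfForwardStep (P : Problem H) (s : Iterates H) (k : ℕ) (i : Fin (m + 1)) : Prop :=
  0 < s.ρ k i ∧
  s.x k i ∈ resolventOp (s.ρ k i • P.A i) (forwardPoint P s k i) ∧
  s.y k i = (s.ρ k i)⁻¹ • (P.G i (s.z k) - s.x k i) + s.w k i
    + (P.B i (s.x k i) - P.B i (P.G i (s.z k)))

/-- `u_i^k = x_i^k - G_i x_n^k`. -/
def uVec (P : Problem H) (s : Iterates H) (k : ℕ) (i : Fin (m + 1)) : H i :=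
  s.x k i - P.G i (s.x k (Fin.last m))

variable [∀ i, CompleteSpace (H i)]

/-- `v^k = ∑_{i=1}^{n-1} G_i^* y_i^k + y_n^k`. -/
def vVec (P : Problem H) (s : Iterates H) (k : ℕ) : H (Fin.last m) :=
  ∑ i : Fin m, ContinuousLinearMap.adjoint (P.G i.castSucc) (s.y k i.castSucc)
    + s.y k (Fin.last m)

/-- `φ_k = ⟨z^k, v^k⟩ + ∑_{i<n} ⟨w_i^k, u_i^k⟩
- ∑_{i≤n} [⟨x_i^k, y_i^k⟩ + (1/(4β_i)) ‖x_i^k - G_i z^k‖²]`. -/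
def phiVal (P : Problem H) (s : Iterates H) (k : ℕ) : ℝ :=
  inner ℝ (s.z k) (vVec P s k)
    + ∑ i : Fin m, inner ℝ (s.w k i.castSucc) (uVec P s k i.castSucc)
    - ∑ i : Fin (m + 1), (inner ℝ (s.x k i) (s.y k i)
        + P.quarterInvBeta i * ‖s.x k i - P.G i (s.z k)‖ ^ 2)

/-- `π_k = γ⁻¹ ‖v^k‖² + ∑_{i<n} ‖u_i^k‖²`. -/
def piVal (P : Problem H) (q : Params) (s : Iterates H) (k : ℕ) : ℝ :=
  q.γ⁻¹ * ‖vVec P s k‖ ^ 2 + ∑ i : Fin m, ‖uVec P s k i.castSucc‖ ^ 2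

/-- `α_k = τ_k φ_k / π_k`. -/
def alphaVal (P : Problem H) (q : Params) (s : Iterates H) (k : ℕ) : ℝ :=
  s.τ k * (phiVal P s k / piVal P q s k)

/-- The sequences `s` are generated by the algorithm run on the problem `P` with inputs `q`
(from an arbitrary starting point). -/
structure IsRun (P : Problem H) (q : Params) (s : Iterates H) : Prop where
  /-- `w_n^k = - ∑_{i=1}^{n-1} G_i^* w_i^k`. -/
  dual_last : ∀ k, s.w k (Fin.last m) = P.lastDual fun i => s.w k i.castSucc
  /-- The case `w_i^k ∈ T_i(G_i z^k)`. -/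
  step_trivial : ∀ k i, s.w k i ∈ P.T i (P.G i (s.z k)) →
    s.ρ k i = q.ρhat ∧ s.x k i = P.G i (s.z k) ∧ s.y k i = s.w k i
  step_newton : ∀ k i, s.w k i ∉ P.T i (P.G i (s.z k)) → i ∈ P.ID → NewtonStep P q s k i
  step_half_forward : ∀ k i, s.w k i ∉ P.T i (P.G i (s.z k)) → i ∉ P.ID → HalfForwardStep P s k i
  /-- The relaxed projection if `φ_k > 0`. -/
  update : ∀ k, 0 < phiVal P s k →
    s.τ k ∈ Set.Icc q.τlo q.τhi ∧
    s.z (k + 1) = s.z k - (q.γ⁻¹ * alphaVal P q s k) • vVec P s k ∧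
    ∀ i : Fin m, s.w (k + 1) i.castSucc
      = s.w k i.castSucc - alphaVal P q s k • uVec P s k i.castSucc
  /-- No move if `φ_k ≤ 0`. -/
  stay : ∀ k, ¬ 0 < phiVal P s k →
    s.z (k + 1) = s.z k ∧ ∀ i : Fin m, s.w (k + 1) i.castSucc = s.w k i.castSucc

end Algorithm

end ProjSplit

end

open Filter Topology
open scoped Pointwise ENNReal NNReal

noncomputable section

namespace ProjSplit

/-! ### Minimizing a height plus half a squared norm over a closed convex set. -/

section Minimization

variable {V : Type*} [NormedAddCommGroup V] [InnerProductSpace ℝ V]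

/-! Each iteration builds an affine functional of `(z, w)` that is nonpositive on the extended
solution set (`block_le`), takes the value `φ_k` at the current point, and has a gradient of squared
norm `π_k` for the `γ` inner product. The update is thus a relaxed projection onto a half-space
containing all solutions, and the squared distance to every solution drops by at least a constant
times `φ_k ^ 2 / π_k` (`fejer`). In particular the iterates are bounded.

Because `G_n = I` and `w_n = -∑ G_i^* w_i`, the families `(G_i z)` and `(w_i)` are orthogonal, so
`φ_k` splits into one term per block (`phiVal_eq_sum`). The step-size rules make each term dominate
`‖x_i - G_i z‖ ^ 2` and make `‖y_i - w_i‖` at most a multiple of `‖x_i - G_i z‖`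
(`exists_newton_bound`, `exists_half_forward_bound`). For Newton blocks the constants depend on the
bound for the iterates. Hence `π_k ≤ K φ_k`, the Fejér decrease forces `φ_k → 0`, and both gaps tend
strongly to zero.

Weak cluster points are solutions (`mem_T_of_weak_limit`): the orthogonality lets the sum of the
pairings pass to the weak limit, and maximality of each `T_i` (`mem_T_of_related`) then recovers the
individual inclusions. That maximality rests on Minty's theorem, proved by minimizing over the
epigraph of the Fitzpatrick function. Opial's argument (`eq_of_tendsto_dist`) leaves only one
cluster point; compactness is used through ultrafilters instead of subsequences. -/

lemma half_add_norm_sq (p q : V) :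
    ‖(1 / 2 : ℝ) • p + (1 / 2 : ℝ) • q‖ ^ 2
      = ‖p‖ ^ 2 / 2 + ‖q‖ ^ 2 / 2 - ‖p - q‖ ^ 2 / 4 := by
  rw [norm_add_sq_real, norm_sub_sq_real, norm_smul, norm_smul, real_inner_smul_left,
    real_inner_smul_right]
  norm_num
  ring

/-- A quadratically perturbed linear functional that is bounded below on a closed convex subset of
`V × ℝ` has a minimizer. -/
lemma exists_min_add_half_norm_sq [CompleteSpace V] {K : Set (V × ℝ)} (hc : IsClosed K)
    (hconv : Convex ℝ K) (hne : K.Nonempty) (hbd : ∀ p ∈ K, 0 ≤ p.2 + ‖p.1‖ ^ 2 / 2) :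
    ∃ p₀ ∈ K, ∀ p ∈ K, p₀.2 + ‖p₀.1‖ ^ 2 / 2 ≤ p.2 + ‖p.1‖ ^ 2 / 2 := by
  set g : V × ℝ → ℝ := fun p => p.2 + ‖p.1‖ ^ 2 / 2 with hg
  set μ := sInf (g '' K) with hμ
  have hbdd : BddBelow (g '' K) := ⟨0, by rintro _ ⟨p, hp, rfl⟩; exact hbd p hp⟩
  have hle : ∀ p ∈ K, μ ≤ g p := fun p hp => csInf_le hbdd ⟨p, hp, rfl⟩
  have hex : ∀ n : ℕ, ∃ p ∈ K, g p < μ + 1 / ((n : ℝ) + 1) := by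
    intro n
    have hpos : (0 : ℝ) < 1 / ((n : ℝ) + 1) := by positivity
    obtain ⟨_, ⟨p, hp, rfl⟩, h⟩ := exists_lt_of_csInf_lt (hne.image g)
      (show sInf (g '' K) < μ + 1 / ((n : ℝ) + 1) by linarith)
    exact ⟨p, hp, h⟩
  choose p hpK hp using hex
  have hlim : Tendsto (fun n : ℕ => 1 / ((n : ℝ) + 1)) atTop (𝓝 0) :=
    tendsto_one_div_add_atTop_nhds_zero_nat
  have hgl : Tendsto (fun n => g (p n)) atTop (𝓝 μ) := by
    refine tendsto_of_tendsto_of_tendsto_of_le_of_le tendsto_const_nhds ?_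
      (fun n => hle _ (hpK n)) (fun n => (hp n).le)
    simpa using hlim.const_add μ
  -- The midpoint stays in `K`, so `μ ≤ μ + 1 / (N + 1) - ‖·‖ ^ 2 / 8` by the parallelogram
  -- identity; this is where the 8 comes from.
  have hdist : ∀ n k N : ℕ, N ≤ n → N ≤ k →
      dist (p n).1 (p k).1 ≤ Real.sqrt (8 * (1 / ((N : ℝ) + 1))) := by
    intro n k N hn hk
    apply Real.le_sqrt_of_sq_le
    have hmid := hle _ (hconv (hpK n) (hpK k) (by norm_num : (0 : ℝ) ≤ 1 / 2)
      (by norm_num : (0 : ℝ) ≤ 1 / 2) (by norm_num))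
    have h1 : 1 / ((n : ℝ) + 1) ≤ 1 / ((N : ℝ) + 1) := Nat.one_div_le_one_div hn
    have h2 : 1 / ((k : ℝ) + 1) ≤ 1 / ((N : ℝ) + 1) := Nat.one_div_le_one_div hk
    have hpn := hp n
    have hpk := hp k
    simp only [hg, Prod.fst_add, Prod.snd_add, Prod.smul_fst, Prod.smul_snd,
      half_add_norm_sq, smul_eq_mul] at hmid hpn hpk
    rw [dist_eq_norm]
    linarith
  have hcs : CauchySeq (fun n => (p n).1) := by
    refine cauchySeq_of_le_tendsto_0 (fun N : ℕ => Real.sqrt (8 * (1 / ((N : ℝ) + 1)))) hdist ?_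
    have := (hlim.const_mul 8).sqrt
    simpa using this
  obtain ⟨x, hx⟩ := cauchySeq_tendsto_of_complete hcs
  have hx2 : Tendsto (fun n => (p n).2) atTop (𝓝 (μ - ‖x‖ ^ 2 / 2)) := by
    have := hgl.sub ((hx.norm.pow 2).div_const 2)
    refine this.congr fun n => ?_
    simp [hg]
  have hmem : (x, μ - ‖x‖ ^ 2 / 2) ∈ K :=
    hc.mem_of_tendsto (hx.prodMk_nhds hx2) (Eventually.of_forall hpK)
  refine ⟨_, hmem, fun q hq => ?_⟩
  have := hle q hq
  simpa [hg] using this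

/-- First-order optimality for `exists_min_add_half_norm_sq`. -/
lemma exists_variational_ineq [CompleteSpace V] {K : Set (V × ℝ)} (hc : IsClosed K)
    (hconv : Convex ℝ K) (hne : K.Nonempty) (hbd : ∀ p ∈ K, 0 ≤ p.2 + ‖p.1‖ ^ 2 / 2) :
    ∃ p₀ ∈ K, ∀ p ∈ K, p₀.2 ≤ p.2 + inner ℝ p₀.1 (p.1 - p₀.1) := by
  obtain ⟨p₀, h₀, hmin⟩ := exists_min_add_half_norm_sq hc hconv hne hbd
  refine ⟨p₀, h₀, fun p hp => ?_⟩
  by_contra! hlt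
  set e := p₀.2 - (p.2 + inner ℝ p₀.1 (p.1 - p₀.1)) with he
  have hepos : 0 < e := by linarith
  set N := ‖p.1 - p₀.1‖ ^ 2 with hN
  have hN0 : 0 ≤ N := by positivity
  -- Moving from `p₀` towards `p` by `t` gains `t * e` and costs `t ^ 2 * N / 2`; this `t` makes the
  -- gain win, against minimality.
  set t := min 1 (e / (N + 1)) with ht
  have ht0 : 0 < t := lt_min one_pos (by positivity)
  have ht1 : t ≤ 1 := min_le_left _ _
  have htN : t * (N + 1) ≤ e := by
    have : t ≤ e / (N + 1) := min_le_right _ _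
    rwa [le_div_iff₀ (by positivity)] at this
  have hm := hmin _ (hconv h₀ hp (sub_nonneg.2 ht1) ht0.le (by ring))
  have hfst : (1 - t) • p₀.1 + t • p.1 = p₀.1 + t • (p.1 - p₀.1) := by
    rw [sub_smul, one_smul, smul_sub]; abel
  simp only [Prod.fst_add, Prod.snd_add, Prod.smul_fst, Prod.smul_snd, smul_eq_mul, hfst] at hm
  rw [norm_add_sq_real, norm_smul, real_inner_smul_right, mul_pow, Real.norm_eq_abs, sq_abs,
    ← hN] at hm
  have h2 : t * e ≤ t ^ 2 * N / 2 := by rw [he]; linarith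
  have h3 : t * (t * (N + 1)) ≤ t * e := mul_le_mul_of_nonneg_left htN ht0.le
  nlinarith [mul_pos ht0 ht0]

end Minimization

/-! ### Monotone and cocoercive operators, Minty's theorem, linearization, weak compactness. -/

section SingleSpace

variable {E : Type*} [NormedAddCommGroup E] [InnerProductSpace ℝ E]

/-- Adjoining the pair `(a, b)` to the graph keeps it monotone, so by maximality the pair was
already there. -/
lemma IsMaximalMonotone.mem_of_related {A : E → Set E} (hA : IsMaximalMonotone A) {a b : E}
    (h : ∀ ξ, ∀ η ∈ A ξ, 0 ≤ inner ℝ (a - ξ) (b - η)) : b ∈ A a := by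
  have hS := hA.2 (fun z => A z ∪ {v | z = a ∧ v = b}) ?_ (fun z => Set.subset_union_left)
  · rw [← hS]; exact Or.inr ⟨rfl, rfl⟩
  · rintro z z' v v' (hv | ⟨rfl, rfl⟩) (hv' | ⟨rfl, rfl⟩)
    · exact hA.1 hv hv'
    · have := h z v hv
      rwa [← neg_sub z, ← neg_sub v, inner_neg_neg] at this
    · exact h _ _ hv'
    · simp

lemma IsMaximalMonotone.exists_mem {A : E → Set E} (hA : IsMaximalMonotone A) :
    ∃ ξ, ∃ η, η ∈ A ξ := by
  by_contra! h
  exact h 0 0 (hA.mem_of_related fun ξ η hη => absurd hη (h ξ η))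

/-- Minty's theorem at the origin: the operator `A + I` has a zero. -/
theorem exists_neg_mem_of_maximal [CompleteSpace E] {A : E → Set E} (hmono : IsMonotoneOp A)
    (hmax : ∀ a b : E, (∀ ξ, ∀ η ∈ A ξ, 0 ≤ inner ℝ (a - ξ) (b - η)) → b ∈ A a) :
    ∃ ξ, -ξ ∈ A ξ := by
  classical
  obtain ⟨x₁, y₁, h₁⟩ : ∃ ξ, ∃ η, η ∈ A ξ := by
    by_contra! h
    exact h 0 0 (hmax _ _ fun ξ η hη => absurd hη (h ξ η))
  -- `K` is the epigraph of the Fitzpatrick function of `A`. Monotonicity puts the points `(ξ, η,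
  -- ⟨ξ, η⟩)` of the graph in it, and maximality makes the function dominate the duality pairing.
  let K : Set (WithLp 2 (E × E) × ℝ) := {p | ∀ ξ, ∀ η ∈ A ξ,
    inner ℝ p.1.fst η + inner ℝ ξ p.1.snd - inner ℝ ξ η ≤ p.2}
  have hcf : Continuous (fun p : WithLp 2 (E × E) × ℝ => p.1.fst) :=
    (WithLp.continuous_fst 2 E E).comp continuous_fst
  have hcs : Continuous (fun p : WithLp 2 (E × E) × ℝ => p.1.snd) :=
    (WithLp.continuous_snd 2 E E).comp continuous_fst
  have hKc : IsClosed K := by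
    simp only [K, Set.ofPred_forall]
    refine isClosed_iInter fun ξ => isClosed_iInter fun η => isClosed_iInter fun _ => ?_
    exact isClosed_le (((hcf.inner continuous_const).add
      (continuous_const.inner hcs)).sub continuous_const) continuous_snd
  have hKconv : Convex ℝ K := by
    intro p hp q hq a b ha hb hab ξ η hη
    have h1 := mul_le_mul_of_nonneg_left (hp ξ η hη) ha
    have h2 := mul_le_mul_of_nonneg_left (hq ξ η hη) hb
    simp only [Prod.fst_add, Prod.snd_add, Prod.smul_fst, Prod.smul_snd, smul_eq_mul,
      WithLp.add_fst, WithLp.add_snd, WithLp.smul_fst, WithLp.smul_snd, inner_add_left,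
      inner_add_right, real_inner_smul_left, real_inner_smul_right]
    obtain rfl : b = 1 - a := by linarith
    linarith
  have hgraph : ∀ ξ, ∀ η ∈ A ξ, ((WithLp.toLp 2 (ξ, η) : WithLp 2 (E × E)), (inner ℝ ξ η : ℝ)) ∈ K := by
    intro ξ η hη ξ' η' hη'
    have := hmono hη hη'
    simp only [inner_sub_left, inner_sub_right] at this
    change inner ℝ ξ η' + inner ℝ ξ' η - inner ℝ ξ' η' ≤ inner ℝ ξ η
    linarith
  have hlow : ∀ p ∈ K, inner ℝ p.1.fst p.1.snd ≤ p.2 := by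
    intro p hp
    by_cases hr : ∀ ξ, ∀ η ∈ A ξ, 0 ≤ inner ℝ (p.1.fst - ξ) (p.1.snd - η)
    · have := hp _ _ (hmax _ _ hr)
      linarith
    · push Not at hr
      obtain ⟨ξ, η, hη, hlt⟩ := hr
      have := hp ξ η hη
      simp only [inner_sub_left, inner_sub_right] at hlt
      linarith
  have hnorm : ∀ p : WithLp 2 (E × E), ‖p‖ ^ 2 = ‖p.fst‖ ^ 2 + ‖p.snd‖ ^ 2 := fun p =>
    WithLp.prod_norm_sq_eq_of_L2 p
  obtain ⟨p₀, h₀, hvar⟩ := exists_variational_ineq hKc hKconv ⟨_, hgraph _ _ h₁⟩ (by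
    intro p hp
    have h1 := hlow p hp
    rw [hnorm]
    have h2 : 0 ≤ ‖p.1.fst + p.1.snd‖ ^ 2 := by positivity
    rw [norm_add_sq_real] at h2
    linarith)
  set x := p₀.1.fst with hx
  set y := p₀.1.snd with hy
  have hxy := hlow _ h₀
  -- Optimality tested on graph points. It makes `(-y, -x)` related to the graph, hence a member;
  -- testing it against itself then gives `x = -y`.
  have key : ∀ ξ, ∀ η ∈ A ξ, ‖x + y‖ ^ 2 ≤ inner ℝ (-y - ξ) (-x - η) := by
    intro ξ η hη
    have h := hvar _ (hgraph ξ η hη)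
    rw [WithLp.prod_inner_apply] at h
    change p₀.2 ≤ inner ℝ ξ η + (inner ℝ x (ξ - x) + inner ℝ y (η - y)) at h
    rw [norm_add_sq_real]
    simp only [inner_sub_left, inner_sub_right, inner_neg_left, inner_neg_right,
      real_inner_self_eq_norm_sq] at h ⊢
    rw [real_inner_comm x y, real_inner_comm ξ x] at *
    rw [← hx, ← hy] at hxy
    linarith
  have hmem : -x ∈ A (-y) := hmax _ _ fun ξ η hη => (sq_nonneg _).trans (key ξ η hη)
  have h0 := key _ _ hmem
  simp only [sub_self, inner_zero_left] at h0
  have h1 : x + y = 0 := by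
    have : ‖x + y‖ = 0 := by nlinarith [norm_nonneg (x + y)]
    exact norm_eq_zero.1 this
  refine ⟨-y, ?_⟩
  have : x = -y := eq_neg_of_add_eq_zero_left h1
  rwa [← this] at hmem ⊢

/-- Minty's theorem: `A + c I` is surjective. -/
theorem IsMaximalMonotone.exists_sub_smul_mem [CompleteSpace E] {A : E → Set E}
    (hA : IsMaximalMonotone A) {c : ℝ} (hc : 0 < c) (s : E) : ∃ ξ, s - c • ξ ∈ A ξ := by
  -- A zero of this shifted and rescaled operator plus the identity is exactly the required `ξ`.
  have hmono : IsMonotoneOp fun z => {v | s + c • v ∈ A z} := by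
    intro z z' v v' hv hv'
    have := hA.1 hv hv'
    rw [add_sub_add_left_eq_sub, ← smul_sub, real_inner_smul_right] at this
    exact (mul_nonneg_iff_of_pos_left hc).1 this
  obtain ⟨ξ, hξ⟩ := exists_neg_mem_of_maximal hmono (by
    intro a b h
    refine hA.mem_of_related fun ξ η hη => ?_
    have h1 := h ξ (c⁻¹ • (η - s)) (by
      change s + c • c⁻¹ • (η - s) ∈ A ξ
      rwa [smul_inv_smul₀ hc.ne', add_sub_cancel])
    have h2 : s + c • b - η = c • (b - c⁻¹ • (η - s)) := by
      rw [smul_sub, smul_inv_smul₀ hc.ne']; abel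
    rw [h2, real_inner_smul_right]
    positivity)
  have hξ' : s + c • -ξ ∈ A ξ := hξ
  exact ⟨ξ, by rwa [smul_neg, ← sub_eq_add_neg] at hξ'⟩

/-- If `A` is maximal monotone and `F` is everywhere defined with at most quadratic growth around
`a`, then a pair `(a, b)` monotonically related to the graph of `A + F` belongs to it. -/
theorem IsMaximalMonotone.sub_mem_of_related_add [CompleteSpace E] {A : E → Set E}
    (hA : IsMaximalMonotone A) {F : E → E} {a b : E} {L M : ℝ} (hL : 0 ≤ L) (hM : 0 ≤ M)
    (hF : ∀ x, ‖F x - F a‖ ≤ L * ‖x - a‖ + M * ‖x - a‖ ^ 2)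
    (h : ∀ ξ, ∀ η ∈ A ξ, 0 ≤ inner ℝ (a - ξ) (b - (η + F ξ))) : b - F a ∈ A a := by
  obtain ⟨x₁, y₁, h₁⟩ := hA.exists_mem
  set d := a - x₁ with hd
  set g := b - F a - y₁ with hg
  -- Monotonicity against `(x₁, y₁)` gives `‖e‖ ≤ 2 * (‖d‖ + ‖g‖)` for every `c ≥ 1`, so `c` can be
  -- taken larger than `L + M * ‖e‖`. Relatedness at the Minty point gives `c * ‖e‖ ^ 2 ≤ (L + M *
  -- ‖e‖) * ‖e‖ ^ 2`, which forces `e = 0`.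
  set c := L + M * (2 * (‖d‖ + ‖g‖)) + 1 with hc
  have hc1 : 1 ≤ c := by
    have : 0 ≤ M * (2 * (‖d‖ + ‖g‖)) := by positivity
    linarith
  obtain ⟨ξ, hξ⟩ := hA.exists_sub_smul_mem (zero_lt_one.trans_le hc1) (b - F a + c • a)
  set e := a - ξ with he
  have hη : b - F a + c • a - c • ξ = b - F a + c • e := by rw [he, smul_sub]; abel
  rw [hη] at hξ
  have hrel := h ξ _ hξ
  have e1 : b - (b - F a + c • e + F ξ) = -(c • e) - (F ξ - F a) := by abel
  rw [e1, ← he, inner_sub_right, inner_neg_right, real_inner_smul_right,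
    real_inner_self_eq_norm_sq] at hrel
  have hF' := hF ξ
  rw [norm_sub_rev ξ a, ← he] at hF'
  have hcs := abs_real_inner_le_norm e (F ξ - F a)
  have hcs' := neg_le_of_abs_le hcs
  have hup : ‖e‖ * ‖F ξ - F a‖ ≤ ‖e‖ * (L * ‖e‖ + M * ‖e‖ ^ 2) :=
    mul_le_mul_of_nonneg_left hF' (norm_nonneg _)
  have hbound : ‖e‖ ≤ 2 * (‖d‖ + ‖g‖) := by
    have hm := hA.1 hξ h₁
    have e2 : ξ - x₁ = d - e := by rw [hd, he]; abel
    have e3 : b - F a + c • e - y₁ = g + c • e := by rw [hg]; abel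
    rw [e2, e3] at hm
    simp only [inner_sub_left, inner_add_right, real_inner_smul_right,
      real_inner_self_eq_norm_sq] at hm
    have i1 := real_inner_le_norm d g
    have i2 := neg_le_of_abs_le (abs_real_inner_le_norm e g)
    have i3 := real_inner_le_norm d e
    have nd := norm_nonneg d
    have ng := norm_nonneg g
    have ne := norm_nonneg e
    by_contra! hlt
    have i4 : c * inner ℝ d e ≤ c * (‖d‖ * ‖e‖) :=
      mul_le_mul_of_nonneg_left i3 (by linarith)
    have i5 : c * (‖e‖ ^ 2 - ‖d‖ * ‖e‖) ≤ ‖d‖ * ‖g‖ + ‖e‖ * ‖g‖ := by linarith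
    have i6 : 0 ≤ ‖e‖ ^ 2 - ‖d‖ * ‖e‖ := by nlinarith
    have i7 : ‖e‖ ^ 2 - ‖d‖ * ‖e‖ ≤ ‖d‖ * ‖g‖ + ‖e‖ * ‖g‖ := by nlinarith
    nlinarith [mul_nonneg nd ng, sq_nonneg (‖d‖ - ‖g‖)]
  have he0 : ‖e‖ = 0 := by
    by_contra hne
    have hpos : 0 < ‖e‖ := lt_of_le_of_ne (norm_nonneg _) (Ne.symm hne)
    have j1 : c * ‖e‖ ^ 2 ≤ ‖e‖ ^ 2 * (L + M * ‖e‖) := by nlinarith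
    have j2 : M * ‖e‖ ≤ M * (2 * (‖d‖ + ‖g‖)) := mul_le_mul_of_nonneg_left hbound hM
    have j3 : 0 < ‖e‖ ^ 2 := by positivity
    have j4 : c ≤ L + M * ‖e‖ := by
      rw [mul_comm] at j1
      exact le_of_mul_le_mul_left j1 j3
    linarith
  have he0' := norm_eq_zero.1 he0
  have hξa : ξ = a := by rw [he] at he0'; exact (sub_eq_zero.1 he0').symm
  rw [he0', smul_zero, add_zero, hξa] at hξ
  exact hξ

/-- A map with `m`-Lipschitz derivative is approximated by its linearization up to
`m / 2 * ‖x - u‖ ^ 2`. -/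
lemma norm_sub_linearization_le {D : E → E} {L : ℝ} (hD : ContDiff ℝ 1 D)
    (hL : ∀ x y, ‖fderiv ℝ D x - fderiv ℝ D y‖ ≤ L * ‖x - y‖) (u x : E) :
    ‖D x - linearization D u x‖ ≤ L / 2 * ‖x - u‖ ^ 2 := by
  set v := x - u with hv
  have hdiff : Differentiable ℝ D := hD.differentiable (by norm_num)
  -- The Taylor remainder along the segment: its derivative is at most `L * ‖v‖ ^ 2 * t` in norm,
  -- and it is compared with the primitive of that bound.
  let f : ℝ → E := fun t => D (u + t • v) - D u - t • fderiv ℝ D u v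
  have hline : ∀ t : ℝ, HasDerivAt (fun t : ℝ => u + t • v) v t := fun t => by
    simpa using ((hasDerivAt_id t).smul_const v).const_add u
  have hf : ∀ t : ℝ, HasDerivAt f (fderiv ℝ D (u + t • v) v - fderiv ℝ D u v) t := by
    intro t
    have h1 := (hdiff (u + t • v)).hasFDerivAt.comp_hasDerivAt t (hline t)
    have h2 : HasDerivAt (fun t : ℝ => t • fderiv ℝ D u v) (fderiv ℝ D u v) t := by
      simpa using (hasDerivAt_id t).smul_const (fderiv ℝ D u v)
    exact (h1.sub_const (D u)).sub h2
  have hB : ∀ t : ℝ, HasDerivAt (fun t : ℝ => L / 2 * ‖v‖ ^ 2 * t ^ 2) (L * ‖v‖ ^ 2 * t) t := by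
    intro t
    refine ((hasDerivAt_pow 2 t).const_mul (L / 2 * ‖v‖ ^ 2)).congr_deriv ?_
    norm_num
    ring
  have := image_norm_le_of_norm_deriv_right_le_deriv_boundary (a := 0) (b := 1) (f := f)
    (fun t _ => (hf t).continuousAt.continuousWithinAt) (fun t _ => (hf t).hasDerivWithinAt)
    (B := fun t : ℝ => L / 2 * ‖v‖ ^ 2 * t ^ 2) (by simp [f]) hB
    (fun t ht => by
      rw [← sub_apply]
      refine (ContinuousLinearMap.le_opNorm _ _).trans ?_
      have h3 := hL (u + t • v) u
      rw [add_sub_cancel_left, norm_smul, Real.norm_eq_abs, abs_of_nonneg ht.1] at h3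
      have := mul_le_mul_of_nonneg_right h3 (norm_nonneg v)
      linarith)
    (Set.right_mem_Icc.2 zero_le_one)
  have hfx : f 1 = D x - linearization D u x := by
    simp [f, linearization, hv, sub_sub]
  rw [hfx] at this
  simpa using this

lemma IsMonotoneMap.inner_fderiv_nonneg {D : E → E} (hm : IsMonotoneMap D) {a : E}
    (hD : DifferentiableAt ℝ D a) (v : E) : 0 ≤ inner ℝ v (fderiv ℝ D a v) := by
  have hlim : Tendsto (fun t : ℝ => t⁻¹ • (D (a + t • v) - D a)) (𝓝[>] 0)
      (𝓝 (fderiv ℝ D a v)) := by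
    have h1 := hD.hasFDerivAt.hasLineDerivAt v
    exact h1.tendsto_slope_zero_right
  have hlim2 : Tendsto (fun t : ℝ => inner ℝ v (t⁻¹ • (D (a + t • v) - D a))) (𝓝[>] 0)
      (𝓝 (inner ℝ v (fderiv ℝ D a v))) := tendsto_const_nhds.inner hlim
  refine ge_of_tendsto hlim2 ?_
  filter_upwards [self_mem_nhdsWithin] with t (ht : 0 < t)
  have h2 := hm (a + t • v) a
  rw [add_sub_cancel_left, real_inner_smul_left] at h2
  rw [real_inner_smul_right]
  have := (mul_nonneg_iff_of_pos_left ht).1 h2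
  positivity

/-- Dividing by `β` leaves an inequality in the reals that also covers `β = ∞`, where the constant
is zero and `C` does not vary. -/
lemma IsCocoercive.norm_sq_le {β : ℝ≥0∞} {C : E → E} (hβ : 0 < β) (hC : IsCocoercive β C)
    (x y : E) : ‖C x - C y‖ ^ 2 ≤ (β⁻¹).toReal * inner ℝ (x - y) (C x - C y) := by
  have h := hC x y
  rcases eq_or_ne β ⊤ with rfl | hfin
  · rcases (sq_nonneg ‖C x - C y‖).eq_or_lt with h0 | h0
    · rw [← h0]; simp
    · rw [EReal.coe_ennreal_top, EReal.top_mul_coe_of_pos h0] at h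
      exact absurd (top_le_iff.1 h) (EReal.coe_ne_top _)
  · lift β to ℝ≥0 using hfin
    have hb : 0 < (β : ℝ) := by exact_mod_cast hβ
    have h' : (β : ℝ) * ‖C x - C y‖ ^ 2 ≤ inner ℝ (x - y) (C x - C y) := by
      have e : ((β : ℝ≥0∞) : EReal) = ((β : ℝ) : EReal) := rfl
      rw [e, ← EReal.coe_mul] at h
      exact_mod_cast h
    rw [ENNReal.toReal_inv, ENNReal.coe_toReal, inv_mul_eq_div, le_div_iff₀ hb]
    linarith

lemma IsCocoercive.isMonotoneMap {β : ℝ≥0∞} {C : E → E} (hC : IsCocoercive β C) :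
    IsMonotoneMap C := by
  intro x y
  have h : (0 : EReal) ≤ (β : EReal) * ((‖C x - C y‖ ^ 2 : ℝ) : EReal) :=
    mul_nonneg (EReal.coe_ennreal_nonneg β) (EReal.coe_nonneg.2 (sq_nonneg _))
  exact_mod_cast h.trans (hC x y)

lemma IsCocoercive.norm_sub_le {β : ℝ≥0∞} {C : E → E} (hβ : 0 < β) (hC : IsCocoercive β C)
    (x y : E) : ‖C x - C y‖ ≤ (β⁻¹).toReal * ‖x - y‖ := by
  have h := hC.norm_sq_le hβ x y
  have h2 : (β⁻¹).toReal * inner ℝ (x - y) (C x - C y)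
      ≤ (β⁻¹).toReal * (‖x - y‖ * ‖C x - C y‖) :=
    mul_le_mul_of_nonneg_left (real_inner_le_norm _ _) ENNReal.toReal_nonneg
  rcases (norm_nonneg (C x - C y)).eq_or_lt with h0 | h0
  · rw [← h0]; positivity
  · refine le_of_mul_le_mul_right ?_ h0
    nlinarith

/-- Evaluating `C` at `a` instead of `x` spoils monotonicity, but cocoercivity and a completed
square limit the loss to `‖x - a‖ ^ 2 / (4β)`. This is the correction term in `φ_k`. -/
lemma IsCocoercive.inner_ge {β : ℝ≥0∞} {C : E → E} (hβ : 0 < β) (hC : IsCocoercive β C)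
    (x a y : E) :
    -((β⁻¹).toReal / 4 * ‖x - a‖ ^ 2) ≤ inner ℝ (x - y) (C a - C y) := by
  have h := hC.norm_sq_le hβ a y
  have hm := hC.isMonotoneMap a y
  set b := (β⁻¹).toReal
  have hb : 0 ≤ b := ENNReal.toReal_nonneg
  have e : x - y = (x - a) + (a - y) := by abel
  rw [e, inner_add_left]
  have h2 := neg_le_of_abs_le (abs_real_inner_le_norm (x - a) (C a - C y))
  rcases hb.eq_or_lt with h0 | h0
  · rw [← h0, zero_mul] at h
    have : ‖C a - C y‖ = 0 := by nlinarith [norm_nonneg (C a - C y)]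
    rw [this] at h2
    rw [← h0]
    linarith
  · refine le_of_mul_le_mul_left ?_ h0
    nlinarith [sq_nonneg (b / 2 * ‖x - a‖ - ‖C a - C y‖)]

/-- A bounded sequence in a Hilbert space has a weak limit along every ultrafilter. -/
lemma exists_weak_limit_ultrafilter [CompleteSpace E] {x : ℕ → E} {R : ℝ}
    (hR : ∀ k, ‖x k‖ ≤ R) (U : Ultrafilter ℕ) :
    ∃ l, ∀ q, Tendsto (fun k => inner ℝ q (x k)) U (𝓝 (inner ℝ q l)) := by
  -- The Riesz map sends the sequence into a dual ball, compact by Banach–Alaoglu; an ultrafilter on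
  -- it converges without any separability.
  let f : ℕ → WeakDual ℝ E := fun k => StrongDual.toWeakDual (InnerProductSpace.toDual ℝ E (x k))
  have hK := WeakDual.isCompact_closedBall (0 : StrongDual ℝ E) R
  obtain ⟨g, -, hg⟩ := hK.ultrafilter_le_nhds (U.map f) (by
    rw [le_principal_iff]
    refine Filter.mem_map.2 (Filter.univ_mem' fun k => ?_)
    simpa [f] using hR k)
  refine ⟨(InnerProductSpace.toDual ℝ E).symm (WeakDual.toStrongDual g), fun q => ?_⟩
  have hev : Tendsto (fun φ : WeakDual ℝ E => φ q) (𝓝 g) (𝓝 (g q)) :=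
    (WeakDual.eval_continuous q).tendsto g
  have := hev.comp (show Tendsto f U (𝓝 g) from hg)
  rw [real_inner_comm, InnerProductSpace.toDual_symm_apply]
  refine this.congr fun k => ?_
  change inner ℝ (x k) q = _
  rw [real_inner_comm]

lemma weakTendsto_of_forall_inner [CompleteSpace E] {x : ℕ → E} {l : E}
    (h : ∀ q, Tendsto (fun k => inner ℝ q (x k)) atTop (𝓝 (inner ℝ q l))) :
    WeakTendsto x l := by
  unfold WeakTendsto
  refine (WeakBilin.tendsto_iff_forall_eval_tendsto _ ?_).2 fun f => ?_
  · intro a b hab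
    refine ext_inner_left ℝ fun q => ?_
    have := LinearMap.congr_fun hab (InnerProductSpace.toDual ℝ E q)
    exact this
  · have := h ((InnerProductSpace.toDual ℝ E).symm f)
    simp only [InnerProductSpace.toDual_symm_apply] at this
    exact this

end SingleSpace

/-! ### Estimates for one resolvent step in one block. -/

section SingleStep

variable {E : Type*} [NormedAddCommGroup E] [InnerProductSpace ℝ E]

lemma inv_smul_sub_mem_of_mem_resolventOp {S : E → Set E} {ρ : ℝ} (hρ : ρ ≠ 0) {p x : E}
    (hx : x ∈ resolventOp (ρ • S) p) : ρ⁻¹ • (p - x) ∈ S x := by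
  obtain ⟨_, ⟨α, hα, rfl⟩, x', hx', h⟩ := hx
  obtain rfl : x' = x := hx'
  have h' : ρ • α + x' = p := h
  rw [← h', add_sub_cancel_right, inv_smul_smul₀ hρ]
  exact hα

lemma inv_smul_forward_sub {ρ : ℝ} (hρ : ρ ≠ 0) (a w e x : E) :
    ρ⁻¹ • (a + ρ • w - ρ • e - x) = ρ⁻¹ • (a - x) + w - e := by
  have : a + ρ • w - ρ • e - x = (a - x) + ρ • (w - e) := by rw [smul_sub]; abel
  rw [this, smul_add, inv_smul_smul₀ hρ]
  abel

/-- Lower bound for the separation produced by a backward half-forward step. -/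
lemma half_forward_inner_ge {a x d e : E} {ρ ℓ κ c : ℝ} (he : ‖e‖ ≤ ℓ * ‖x - a‖)
    (hc : c ≤ ρ⁻¹ - (κ + ℓ)) (hd : d = ρ⁻¹ • (a - x) + e) :
    c * ‖x - a‖ ^ 2 ≤ inner ℝ (a - x) d - κ * ‖x - a‖ ^ 2 := by
  rw [hd, inner_add_right, real_inner_smul_right, real_inner_self_eq_norm_sq, norm_sub_rev a x]
  have h1 := neg_le_of_abs_le (abs_real_inner_le_norm (a - x) e)
  rw [norm_sub_rev a x] at h1
  have h2 := mul_le_mul_of_nonneg_left he (norm_nonneg (x - a))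
  have h3 := mul_le_mul_of_nonneg_right hc (sq_nonneg ‖x - a‖)
  linarith

/-- Lower bound for the separation produced by a proximal-Newton step. -/
lemma newton_inner_ge {a x d e f : E} {ρ ℓ m b δ : ℝ} (hρ : 0 < ρ)
    (he : ‖e‖ ≤ ℓ * ‖x - a‖) (hf : ‖f‖ ≤ m / 2 * ‖x - a‖ ^ 2)
    (hΘ : 4 * ℓ ^ 2 * ρ ^ 2 + (b + δ) * ρ + (m * ρ * ‖x - a‖) ^ 2 ≤ 2)
    (hd : d = ρ⁻¹ • (a - x) + e + f) :
    δ / 4 * ‖x - a‖ ^ 2 ≤ inner ℝ (a - x) d - b / 4 * ‖x - a‖ ^ 2 := by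
  rw [hd, inner_add_right, inner_add_right, real_inner_smul_right, real_inner_self_eq_norm_sq,
    norm_sub_rev a x]
  have h1 := neg_le_of_abs_le (abs_real_inner_le_norm (a - x) e)
  have h1' := neg_le_of_abs_le (abs_real_inner_le_norm (a - x) f)
  rw [norm_sub_rev a x] at h1 h1'
  set r := ‖x - a‖ with hr
  have hr0 : 0 ≤ r := norm_nonneg _
  have h2 := mul_le_mul_of_nonneg_left he hr0
  have h3 := mul_le_mul_of_nonneg_left hf hr0
  -- By `4t ≤ 4t ^ 2 + 1` at `t = ρ * ℓ` and `2t ≤ t ^ 2 + 1` at `t = m * ρ * r`, four times the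
  -- left side times `ρ` is at most the line-search quantity plus 2, hence at most 4.
  have key : ℓ + m / 2 * r + (b + δ) / 4 ≤ ρ⁻¹ := by
    rw [← one_div, le_div_iff₀ hρ]
    nlinarith [sq_nonneg (2 * (ρ * ℓ) - 1), sq_nonneg (m * ρ * r - 1)]
  have h4 := mul_le_mul_of_nonneg_right key (sq_nonneg r)
  linarith

/-- The resolvent point of a proximal-Newton step stays within an explicit distance of any point
of the domain. -/
lemma norm_sub_le_of_newton {A : E → Set E} (hA : IsMonotoneOp A) {D : E → E}
    (hm : IsMonotoneMap D) {a x w e x' η : E} (hdiff : DifferentiableAt ℝ D a) {ρ : ℝ}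
    (hρ : 0 < ρ) (hx : ρ⁻¹ • (a - x) + w - e - linearization D a x ∈ A x) (hη : η ∈ A x') :
    ‖x - x'‖ ≤ ‖a - x'‖ + ρ * ‖w - e - η - linearization D a x'‖ := by
  have h := hA hx hη
  have hlin : linearization D a x = linearization D a x' + fderiv ℝ D a (x - x') := by
    simp only [linearization, map_sub]; abel
  set g := w - e - η - linearization D a x' with hg
  have e1 : ρ⁻¹ • (a - x) + w - e - linearization D a x - η
      = ρ⁻¹ • (a - x') - ρ⁻¹ • (x - x') + g - fderiv ℝ D a (x - x') := by
    rw [← smul_sub, hlin, hg]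
    have : a - x = a - x' - (x - x') := by abel
    rw [this]
    abel
  rw [e1, inner_sub_right, inner_add_right, inner_sub_right, real_inner_smul_right,
    real_inner_smul_right, real_inner_self_eq_norm_sq] at h
  -- Positivity of the derivative lets the linearized term be dropped from the monotonicity
  -- inequality.
  have h1 := hm.inner_fderiv_nonneg hdiff (x - x')
  have h2 := real_inner_le_norm (x - x') (a - x')
  have h3 := real_inner_le_norm (x - x') g
  set r := ‖x - x'‖ with hr
  have hr0 : 0 ≤ r := norm_nonneg _
  have hρ' : 0 < ρ⁻¹ := inv_pos.2 hρ
  have h4 := mul_le_mul_of_nonneg_left h2 hρ'.le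
  have h5 : ρ⁻¹ * r ^ 2 ≤ ρ⁻¹ * (r * ‖a - x'‖) + r * ‖g‖ := by linarith
  rcases hr0.eq_or_lt with h0 | h0
  · rw [← h0]; positivity
  · have h6 := mul_le_mul_of_nonneg_left h5 hρ.le
    rw [mul_add, mul_inv_cancel_left₀ hρ.ne', mul_inv_cancel_left₀ hρ.ne'] at h6
    refine le_of_mul_le_mul_left ?_ h0
    linarith

/-- Uniform estimates for proximal-Newton steps taken from a bounded set. -/
lemma exists_newton_bound {A : E → Set E} (hA : IsMonotoneOp A) {B C D : E → E} {ℓ m : ℝ≥0}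
    {β : ℝ≥0∞} (hB : LipschitzWith ℓ B) (hβ : 0 < β) (hC : IsCocoercive β C)
    (hDm : IsMonotoneMap D) (hD : ContDiff ℝ 1 D)
    (hDL : ∀ x y, ‖fderiv ℝ D x - fderiv ℝ D y‖ ≤ (m : ℝ) * ‖x - y‖)
    {x' η : E} (hη : η ∈ A x') {δ θlo θhi R : ℝ} (hδ : 0 < δ) (hθ : 0 < θlo) (hθ2 : θhi < 2) :
    ∃ K : ℝ, 0 < K ∧ ∀ (a w x y : E) (ρ : ℝ), ‖a - x'‖ ≤ R → ‖w‖ ≤ R → 0 < ρ →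
      ρ⁻¹ • (a - x) + w - (B a + C a) - linearization D a x ∈ A x →
      y = ρ⁻¹ • (a - x) + w + (B x - B a) + (D x - linearization D a x) →
      4 * (ℓ : ℝ) ^ 2 * ρ ^ 2 + ((β⁻¹).toReal + δ) * ρ + ((m : ℝ) * ρ * ‖x - a‖) ^ 2
        ∈ Set.Icc θlo θhi →
      ‖x - a‖ ^ 2 ≤ K * (inner ℝ (a - x) (y - w) - (β⁻¹).toReal / 4 * ‖x - a‖ ^ 2) ∧
      ‖y - w‖ ≤ K * ‖x - a‖ := by
  set b := (β⁻¹).toReal with hb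
  have hb0 : 0 ≤ b := ENNReal.toReal_nonneg
  have hℓ0 : (0 : ℝ) ≤ ℓ := ℓ.2
  have hm0 : (0 : ℝ) ≤ m := m.2
  set R₀ := |R|
  have hR₀ : 0 ≤ R₀ := abs_nonneg R
  -- The upper line-search bound gives `δ * ρ < 2`, so `ρ ≤ ρm`. Then `Γ` bounds the residual at
  -- `x'`, `R₁` bounds `‖x - a‖`, and `K₁` satisfies `θlo ≤ K₁ * ρ`.
  set ρm := 2 / δ with hρm
  have hρm0 : 0 < ρm := by positivity
  set Γ := R₀ + (‖B x'‖ + ℓ * R₀ + (‖C x'‖ + b * R₀)) + ‖η‖ + (‖D x'‖ + m / 2 * R₀ ^ 2) with hΓ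
  have hΓ0 : 0 ≤ Γ := by positivity
  set R₁ := 2 * R₀ + ρm * Γ with hR₁
  have hR₁0 : 0 ≤ R₁ := by positivity
  set K₁ := 4 * (ℓ : ℝ) ^ 2 * ρm + (b + δ) + (m * R₁) ^ 2 * ρm with hK₁
  have hK₁0 : 0 < K₁ := by positivity
  set K₂ := K₁ / θlo + ℓ + m / 2 * R₁ with hK₂
  have hK₂0 : 0 < K₂ := by positivity
  refine ⟨max (4 / δ) K₂, lt_max_of_lt_right hK₂0, ?_⟩
  intro a w x y ρ ha hw hρ hx hy hΘ
  have ha' : ‖a - x'‖ ≤ R₀ := ha.trans (le_abs_self R)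
  have hw' : ‖w‖ ≤ R₀ := hw.trans (le_abs_self R)
  have hBx : ‖B x - B a‖ ≤ ℓ * ‖x - a‖ := hB.norm_sub_le x a
  have hDx := norm_sub_linearization_le hD hDL a x
  have hd : y - w = ρ⁻¹ • (a - x) + (B x - B a) + (D x - linearization D a x) := by
    rw [hy]; abel
  have hin := newton_inner_ge hρ hBx hDx (hΘ.2.trans hθ2.le) hd
  have hρle : ρ ≤ ρm := by
    rw [hρm, le_div_iff₀ hδ]
    have := hΘ.2
    have p1 : 0 ≤ 4 * (ℓ : ℝ) ^ 2 * ρ ^ 2 := by positivity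
    have p2 : 0 ≤ ((m : ℝ) * ρ * ‖x - a‖) ^ 2 := by positivity
    have p3 : 0 ≤ b * ρ := by positivity
    linarith
  have hxa : ‖x - a‖ ≤ R₁ := by
    have h1 := norm_sub_le_of_newton hA hDm ((hD.differentiable (by norm_num)) a) hρ hx hη
    have h2 : ‖w - (B a + C a) - η - linearization D a x'‖ ≤ Γ := by
      have hBa : ‖B a‖ ≤ ‖B x'‖ + ℓ * R₀ := by
        have := hB.norm_sub_le a x'
        have t := norm_le_norm_add_norm_sub' (B a) (B x')
        have u := mul_le_mul_of_nonneg_left ha' hℓ0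
        linarith
      have hCa : ‖C a‖ ≤ ‖C x'‖ + b * R₀ := by
        have := hC.norm_sub_le hβ a x'
        have t := norm_le_norm_add_norm_sub' (C a) (C x')
        have u := mul_le_mul_of_nonneg_left ha' hb0
        linarith
      have hDa : ‖linearization D a x'‖ ≤ ‖D x'‖ + m / 2 * R₀ ^ 2 := by
        have q := norm_sub_linearization_le hD hDL a x'
        rw [norm_sub_rev x' a] at q
        have t := norm_le_norm_add_norm_sub (D x') (linearization D a x')
        have u : ‖a - x'‖ ^ 2 ≤ R₀ ^ 2 := pow_le_pow_left₀ (norm_nonneg _) ha' 2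
        have u' : (m : ℝ) / 2 * ‖a - x'‖ ^ 2 ≤ m / 2 * R₀ ^ 2 :=
          mul_le_mul_of_nonneg_left u (by positivity)
        linarith
      have s1 := norm_sub_le (w - (B a + C a) - η) (linearization D a x')
      have s2 := norm_sub_le (w - (B a + C a)) η
      have s3 := norm_sub_le w (B a + C a)
      have s4 := norm_add_le (B a) (C a)
      linarith
    have h3 : ρ * ‖w - (B a + C a) - η - linearization D a x'‖ ≤ ρm * Γ :=
      mul_le_mul hρle h2 (norm_nonneg _) hρm0.le
    have h4 : ‖x - a‖ ≤ ‖x - x'‖ + ‖a - x'‖ := by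
      rw [norm_sub_rev a x']
      exact norm_sub_le_norm_sub_add_norm_sub x x' a
    linarith
  -- The lower line-search bound keeps the step size away from zero, since every term of the tested
  -- quantity is at most a constant times `ρ`.
  have hρinv : ρ⁻¹ ≤ K₁ / θlo := by
    rw [inv_eq_one_div, div_le_div_iff₀ hρ hθ, one_mul]
    refine hΘ.1.trans ?_
    have p1 : 4 * (ℓ : ℝ) ^ 2 * ρ ^ 2 ≤ 4 * (ℓ : ℝ) ^ 2 * ρm * ρ := by
      have : (4 * (ℓ : ℝ) ^ 2 * ρ) * ρ ≤ (4 * (ℓ : ℝ) ^ 2 * ρ) * ρm :=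
        mul_le_mul_of_nonneg_left hρle (by positivity)
      linarith
    have p2 : ((m : ℝ) * ρ * ‖x - a‖) ^ 2 ≤ (m * R₁) ^ 2 * ρm * ρ := by
      have t1 : (m : ℝ) * ρ * ‖x - a‖ ≤ m * ρ * R₁ :=
        mul_le_mul_of_nonneg_left hxa (by positivity)
      have t2 := pow_le_pow_left₀ (by positivity) t1 2
      have t3 : ((m * R₁) ^ 2 * ρ) * ρ ≤ ((m * R₁) ^ 2 * ρ) * ρm :=
        mul_le_mul_of_nonneg_left hρle (by positivity)
      linarith
    rw [hK₁]
    linarith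
  constructor
  · set I := inner ℝ (a - x) (y - w) - b / 4 * ‖x - a‖ ^ 2
    have hI : 0 ≤ I := le_trans (by positivity) hin
    have h1 : ‖x - a‖ ^ 2 ≤ 4 / δ * I := by
      rw [div_mul_eq_mul_div, le_div_iff₀ hδ]
      linarith
    exact h1.trans (mul_le_mul_of_nonneg_right (le_max_left _ _) hI)
  · have h1 : ‖y - w‖ ≤ ρ⁻¹ * ‖x - a‖ + ℓ * ‖x - a‖ + m / 2 * R₁ * ‖x - a‖ := by
      rw [hd]
      have q1 : ‖ρ⁻¹ • (a - x)‖ = ρ⁻¹ * ‖x - a‖ := by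
        rw [norm_smul, norm_sub_rev, Real.norm_eq_abs, abs_of_pos (inv_pos.2 hρ)]
      have q2 : (m : ℝ) / 2 * ‖x - a‖ ^ 2 ≤ m / 2 * R₁ * ‖x - a‖ := by
        have : (m / 2 * ‖x - a‖) * ‖x - a‖ ≤ (m / 2 * ‖x - a‖) * R₁ :=
          mul_le_mul_of_nonneg_left hxa (by positivity)
        linarith
      have q3 := norm_add_le (ρ⁻¹ • (a - x) + (B x - B a)) (D x - linearization D a x)
      have q4 := norm_add_le (ρ⁻¹ • (a - x)) (B x - B a)
      linarith
    have h2 : ρ⁻¹ * ‖x - a‖ ≤ K₁ / θlo * ‖x - a‖ :=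
      mul_le_mul_of_nonneg_right hρinv (norm_nonneg _)
    have h3 : K₂ * ‖x - a‖ ≤ max (4 / δ) K₂ * ‖x - a‖ :=
      mul_le_mul_of_nonneg_right (le_max_right _ _) (norm_nonneg _)
    rw [hK₂] at h3
    linarith

/-- Uniform estimates for backward half-forward steps with step sizes in `[ρlo, ρhi]`. -/
lemma exists_half_forward_bound {B : E → E} {ℓ : ℝ≥0} (hB : LipschitzWith ℓ B) {κ ρlo ρhi : ℝ}
    (hlo : 0 < ρlo) (hhi : ρhi * (κ + ℓ) < 1) :
    ∃ K : ℝ, 0 < K ∧ ∀ (a w x y : E) (ρ : ℝ), ρlo ≤ ρ → ρ ≤ ρhi → 0 ≤ κ →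
      y = ρ⁻¹ • (a - x) + w + (B x - B a) →
      ‖x - a‖ ^ 2 ≤ K * (inner ℝ (a - x) (y - w) - κ * ‖x - a‖ ^ 2) ∧
      ‖y - w‖ ≤ K * ‖x - a‖ := by
  -- With `ρhi ≤ 0` no step size is admissible and the claim is vacuous.
  rcases le_or_gt ρhi 0 with h0 | h0
  · exact ⟨1, one_pos, fun _ _ _ _ ρ h1 h2 => by linarith⟩
  have hℓ0 : (0 : ℝ) ≤ ℓ := ℓ.2
  set c := ρhi⁻¹ - (κ + ℓ) with hc
  have hc0 : 0 < c := by
    rw [hc, sub_pos, ← one_div, lt_div_iff₀ h0]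
    linarith
  refine ⟨max c⁻¹ (ρlo⁻¹ + ℓ), lt_max_of_lt_left (inv_pos.2 hc0), ?_⟩
  intro a w x y ρ h1 h2 hκ hy
  have hρ : 0 < ρ := hlo.trans_le h1
  have hBx : ‖B x - B a‖ ≤ ℓ * ‖x - a‖ := hB.norm_sub_le x a
  have hd : y - w = ρ⁻¹ • (a - x) + (B x - B a) := by rw [hy]; abel
  have hinv : ρhi⁻¹ ≤ ρ⁻¹ := inv_anti₀ hρ h2
  have hin := half_forward_inner_ge (κ := κ) hBx (show c ≤ ρ⁻¹ - (κ + ℓ) by linarith) hd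
  constructor
  · set I := inner ℝ (a - x) (y - w) - κ * ‖x - a‖ ^ 2
    have hI : 0 ≤ I := le_trans (by positivity) hin
    have h1 : ‖x - a‖ ^ 2 ≤ c⁻¹ * I := by
      rw [inv_mul_eq_div, le_div_iff₀ hc0]
      linarith
    exact h1.trans (mul_le_mul_of_nonneg_right (le_max_left _ _) hI)
  · have q1 : ‖ρ⁻¹ • (a - x)‖ = ρ⁻¹ * ‖x - a‖ := by
      rw [norm_smul, norm_sub_rev, Real.norm_eq_abs, abs_of_pos (inv_pos.2 hρ)]
    have q2 := norm_add_le (ρ⁻¹ • (a - x)) (B x - B a)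
    rw [← hd] at q2
    have q3 : ρ⁻¹ * ‖x - a‖ ≤ ρlo⁻¹ * ‖x - a‖ :=
      mul_le_mul_of_nonneg_right (inv_anti₀ hlo h1) (norm_nonneg _)
    have q4 : (ρlo⁻¹ + ℓ) * ‖x - a‖ ≤ max c⁻¹ (ρlo⁻¹ + ℓ) * ‖x - a‖ :=
      mul_le_mul_of_nonneg_right (le_max_right _ _) (norm_nonneg _)
    linarith

end SingleStep

/-! ### Weak convergence along filters. -/

section InnerTendsto

variable {E F : Type*} [NormedAddCommGroup E] [InnerProductSpace ℝ E]
  [NormedAddCommGroup F] [InnerProductSpace ℝ F]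

/-- Weak convergence along a filter, tested by inner products. -/
def InnerTendsto (x : ℕ → E) (l : Filter ℕ) (x₀ : E) : Prop :=
  ∀ q, Tendsto (fun k => inner ℝ q (x k)) l (𝓝 (inner ℝ q x₀))

lemma InnerTendsto.of_sub_tendsto_zero {x y : ℕ → E} {l : Filter ℕ} {x₀ : E}
    (h : InnerTendsto x l x₀) (hxy : Tendsto (fun k => y k - x k) l (𝓝 0)) :
    InnerTendsto y l x₀ := by
  intro q
  have h1 : Tendsto (fun k => inner ℝ q (y k - x k)) l (𝓝 (inner ℝ q 0)) :=
    tendsto_const_nhds.inner hxy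
  have := (h q).add h1
  rw [inner_zero_right, add_zero] at this
  refine this.congr fun k => ?_
  rw [inner_sub_right]; ring

lemma InnerTendsto.map [CompleteSpace E] [CompleteSpace F] {x : ℕ → E} {l : Filter ℕ} {x₀ : E}
    (h : InnerTendsto x l x₀) (G : E →L[ℝ] F) : InnerTendsto (fun k => G (x k)) l (G x₀) := by
  intro q
  have := h (ContinuousLinearMap.adjoint G q)
  simpa only [ContinuousLinearMap.adjoint_inner_left] using this

lemma tendsto_inner_zero_of_bounded {x y : ℕ → E} {l : Filter ℕ} {R : ℝ}
    (hx : ∀ k, ‖x k‖ ≤ R) (hy : Tendsto y l (𝓝 0)) :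
    Tendsto (fun k => inner ℝ (x k) (y k)) l (𝓝 0) := by
  refine squeeze_zero_norm (a := fun k => R * ‖y k‖) (fun k => ?_) ?_
  · exact (norm_inner_le_norm _ _).trans (mul_le_mul_of_nonneg_right (hx k) (norm_nonneg _))
  · simpa using hy.norm.const_mul R

end InnerTendsto

section

variable {m : ℕ} {H : Fin (m + 1) → Type*}
  [∀ i, NormedAddCommGroup (H i)] [∀ i, InnerProductSpace ℝ (H i)]

/-! ### The weighted inner product and Opial's argument. -/

section GammaInner

lemma gammaInner_comm (γ : ℝ) (p q : ProductSpace H) : gammaInner γ p q = gammaInner γ q p := by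
  simp only [gammaInner, real_inner_comm]

lemma gammaInner_sub_left (γ : ℝ) (p q r : ProductSpace H) :
    gammaInner γ (p - q) r = gammaInner γ p r - gammaInner γ q r := by
  simp only [gammaInner, Prod.fst_sub, Prod.snd_sub, Pi.sub_apply, inner_sub_left,
    Finset.sum_sub_distrib]
  ring

lemma gammaInner_sub_right (γ : ℝ) (p q r : ProductSpace H) :
    gammaInner γ p (q - r) = gammaInner γ p q - gammaInner γ p r := by
  rw [gammaInner_comm, gammaInner_sub_left, gammaInner_comm γ q, gammaInner_comm γ r]

lemma gammaInner_self (γ : ℝ) (p : ProductSpace H) :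
    gammaInner γ p p = γ * ‖p.1‖ ^ 2 + ∑ i, ‖p.2 i‖ ^ 2 := by
  simp only [gammaInner, real_inner_self_eq_norm_sq]

lemma gammaInner_self_nonneg {γ : ℝ} (hγ : 0 < γ) (p : ProductSpace H) :
    0 ≤ gammaInner γ p p := by
  rw [gammaInner_self]
  have : 0 ≤ ∑ i, ‖p.2 i‖ ^ 2 := Finset.sum_nonneg fun i _ => sq_nonneg _
  positivity

lemma norm_fst_sq_le {γ : ℝ} (p : ProductSpace H) :
    γ * ‖p.1‖ ^ 2 ≤ gammaInner γ p p := by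
  rw [gammaInner_self]
  have : 0 ≤ ∑ i, ‖p.2 i‖ ^ 2 := Finset.sum_nonneg fun i _ => sq_nonneg _
  linarith

lemma norm_snd_sq_le {γ : ℝ} (hγ : 0 < γ) (p : ProductSpace H) (i : Fin m) :
    ‖p.2 i‖ ^ 2 ≤ gammaInner γ p p := by
  rw [gammaInner_self]
  have h1 := Finset.single_le_sum (f := fun i => ‖p.2 i‖ ^ 2) (fun i _ => sq_nonneg _)
    (Finset.mem_univ i)
  have h2 : 0 ≤ γ * ‖p.1‖ ^ 2 := by positivity
  linarith

lemma eq_zero_of_gammaInner_self {γ : ℝ} (hγ : 0 < γ) {p : ProductSpace H}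
    (h : gammaInner γ p p = 0) : p = 0 := by
  have h1 := norm_fst_sq_le (γ := γ) p
  have h2 : ‖p.1‖ ^ 2 = 0 := by
    have : 0 ≤ ‖p.1‖ ^ 2 := sq_nonneg _
    nlinarith
  refine Prod.ext (by simpa using h2) (funext fun i => ?_)
  have h3 := norm_snd_sq_le hγ p i
  have h4 : ‖p.2 i‖ ^ 2 = 0 := le_antisymm (h3.trans_eq h) (sq_nonneg _)
  simpa using h4

lemma tendsto_gammaInner {γ : ℝ} {p : ℕ → ProductSpace H} {l : Filter ℕ} {p₀ : ProductSpace H}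
    (h1 : InnerTendsto (fun k => (p k).1) l p₀.1)
    (h2 : ∀ i, InnerTendsto (fun k => (p k).2 i) l (p₀.2 i)) (q : ProductSpace H) :
    Tendsto (fun k => gammaInner γ q (p k)) l (𝓝 (gammaInner γ q p₀)) :=
  ((h1 q.1).const_mul γ).add (tendsto_finsetSum _ fun i _ => h2 i (q.2 i))

/-- Two weak limits of `p` along different filters agree if the distances from `p` to both of them
converge (Opial's argument). -/
lemma eq_of_tendsto_dist {γ : ℝ} (hγ : 0 < γ) {p : ℕ → ProductSpace H} {l₁ l₂ : Filter ℕ}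
    [l₁.NeBot] [l₂.NeBot] (hl₁ : l₁ ≤ atTop) (hl₂ : l₂ ≤ atTop) {p₁ p₂ : ProductSpace H}
    (h₁ : ∀ q, Tendsto (fun k => gammaInner γ q (p k)) l₁ (𝓝 (gammaInner γ q p₁)))
    (h₂ : ∀ q, Tendsto (fun k => gammaInner γ q (p k)) l₂ (𝓝 (gammaInner γ q p₂)))
    {d₁ d₂ : ℝ}
    (hd₁ : Tendsto (fun k => gammaInner γ (p k - p₁) (p k - p₁)) atTop (𝓝 d₁))
    (hd₂ : Tendsto (fun k => gammaInner γ (p k - p₂) (p k - p₂)) atTop (𝓝 d₂)) :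
    p₁ = p₂ := by
  -- The difference of the two squared distances is affine in `p k`, so this pairing converges along
  -- `atTop`; its limits along `l₁` and `l₂` must then agree.
  have hlim : Tendsto (fun k => gammaInner γ (p₁ - p₂) (p k)) atTop
      (𝓝 ((d₂ - d₁ + gammaInner γ p₁ p₁ - gammaInner γ p₂ p₂) / 2)) := by
    refine ((((hd₂.sub hd₁).add_const _).sub_const _).div_const 2).congr fun k => ?_
    simp only [gammaInner_sub_left, gammaInner_sub_right, gammaInner_comm γ (p k)]
    ring
  have e1 := tendsto_nhds_unique (h₁ (p₁ - p₂)) (hlim.mono_left hl₁)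
  have e2 := tendsto_nhds_unique (h₂ (p₁ - p₂)) (hlim.mono_left hl₂)
  refine sub_eq_zero.1 (eq_zero_of_gammaInner_self hγ (p := p₁ - p₂) ?_)
  rw [gammaInner_sub_right, e1, e2, sub_self]

end GammaInner

/-- The standing assumptions on the data of the inclusion. -/
structure Problem.IsRegular (P : Problem H) : Prop where
  G_last : P.G (Fin.last m) = ContinuousLinearMap.id ℝ (H (Fin.last m))
  maximal : ∀ i, IsMaximalMonotone (P.A i)
  monotone_B : ∀ i, IsMonotoneMap (P.B i)
  lipschitz_B : ∀ i, LipschitzWith (P.lipB i) (P.B i)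
  β_pos : ∀ i, 0 < P.β i
  cocoercive : ∀ i, IsCocoercive (P.β i) (P.C i)
  monotone_D : ∀ i, IsMonotoneMap (P.D i)
  contDiff_D : ∀ i, ContDiff ℝ 1 (P.D i)
  lipschitz_fderiv_D : ∀ i x y,
    ‖fderiv ℝ (P.D i) x - fderiv ℝ (P.D i) y‖ ≤ (P.lipD i : ℝ) * ‖x - y‖
  D_eq_zero : ∀ i ∉ P.ID, ∀ x, P.D i x = 0

/-! ### The operators `T_i`, primal-dual orthogonality, and the splitting of `φ_k`. -/

namespace Problem

lemma mem_T_iff (P : Problem H) (i : Fin (m + 1)) (x v : H i) :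
    v ∈ P.T i x ↔ v - (P.B i x + P.C i x + P.D i x) ∈ P.A i x := by
  constructor
  · rintro ⟨α, hα, _, rfl, h⟩
    rw [← h]
    simpa using hα
  · intro h
    exact ⟨_, h, _, rfl, sub_add_cancel _ _⟩

lemma quarterInvBeta_eq (P : Problem H) (i : Fin (m + 1)) :
    P.quarterInvBeta i = ((P.β i)⁻¹).toReal / 4 := by
  rw [quarterInvBeta, ENNReal.mul_inv (Or.inl (by norm_num)) (Or.inl (by norm_num)),
    ENNReal.toReal_mul, ENNReal.toReal_inv]
  norm_num
  ring

/-- The product form stays meaningful when `1/(4β) + ℓ = 0` and the extended bound is infinite. -/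
lemma mul_quarterInvBeta_add_lt_one (P : Problem H) {i : Fin (m + 1)} {r : ℝ} (hβ : 0 < P.β i)
    (h : ENNReal.ofReal r < ((4 * P.β i)⁻¹ + (P.lipB i : ℝ≥0∞))⁻¹) :
    r * (P.quarterInvBeta i + P.lipB i) < 1 := by
  have hne : (4 * P.β i)⁻¹ ≠ ⊤ := ENNReal.inv_ne_top.2 (mul_ne_zero (by norm_num) hβ.ne')
  have hκ : P.quarterInvBeta i + P.lipB i = ((4 * P.β i)⁻¹ + (P.lipB i : ℝ≥0∞)).toReal := by
    rw [ENNReal.toReal_add hne ENNReal.coe_ne_top]; rfl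
  have htop : (4 * P.β i)⁻¹ + (P.lipB i : ℝ≥0∞) ≠ ⊤ :=
    ENNReal.add_ne_top.2 ⟨hne, ENNReal.coe_ne_top⟩
  rw [hκ]
  set κ := (4 * P.β i)⁻¹ + (P.lipB i : ℝ≥0∞)
  rcases eq_or_ne κ 0 with h0 | h0
  · simp [h0]
  have hκ0 : 0 < κ.toReal := ENNReal.toReal_pos h0 htop
  rw [← ENNReal.ofReal_toReal htop, ← ENNReal.ofReal_inv_of_pos hκ0,
    ENNReal.ofReal_lt_ofReal_iff (inv_pos.2 hκ0)] at h
  rwa [← one_div, lt_div_iff₀ hκ0] at h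

namespace IsRegular

variable {P : Problem H}

lemma monotone_single (hP : P.IsRegular) (i : Fin (m + 1)) :
    IsMonotoneMap fun x => P.B i x + P.C i x + P.D i x := by
  intro x y
  have h1 := hP.monotone_B i x y
  have h2 := (hP.cocoercive i).isMonotoneMap x y
  have h3 := hP.monotone_D i x y
  rw [add_sub_add_comm, add_sub_add_comm, inner_add_right, inner_add_right]
  linarith

lemma monotone_T (hP : P.IsRegular) (i : Fin (m + 1)) : IsMonotoneOp (P.T i) := by
  intro x x' v v' hv hv'
  rw [mem_T_iff] at hv hv'
  have h1 := (hP.maximal i).1 hv hv'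
  have h2 := hP.monotone_single i x x'
  have e : v - v' = (v - (P.B i x + P.C i x + P.D i x) - (v' - (P.B i x' + P.C i x' + P.D i x')))
      + (P.B i x + P.C i x + P.D i x - (P.B i x' + P.C i x' + P.D i x')) := by abel
  rw [e, inner_add_right]
  exact add_nonneg h1 h2

/-- `T_i = A_i + B_i + C_i + D_i` is maximal among monotone relations. -/
lemma mem_T_of_related [∀ i, CompleteSpace (H i)] (hP : P.IsRegular) {i : Fin (m + 1)} {a b : H i}
    (h : ∀ ξ, ∀ f ∈ P.T i ξ, 0 ≤ inner ℝ (a - ξ) (b - f)) : b ∈ P.T i a := by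
  rw [mem_T_iff]
  -- `B` and `C` contribute their Lipschitz constants to `L`; `D` contributes the norm of its
  -- derivative at `a` to `L` and its Taylor remainder to `M`.
  refine (hP.maximal i).sub_mem_of_related_add (F := fun x => P.B i x + P.C i x + P.D i x)
    (L := P.lipB i + ((P.β i)⁻¹).toReal + ‖fderiv ℝ (P.D i) a‖) (M := P.lipD i / 2)
    (by positivity) (by positivity) (fun x => ?_) fun ξ η hη => ?_
  · have h1 := (hP.lipschitz_B i).norm_sub_le x a
    have h2 := (hP.cocoercive i).norm_sub_le (hP.β_pos i) x a
    have h3 := norm_sub_linearization_le (hP.contDiff_D i) (hP.lipschitz_fderiv_D i) a x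
    have h4 := (fderiv ℝ (P.D i) a).le_opNorm (x - a)
    have e : P.D i x - P.D i a
        = (P.D i x - linearization (P.D i) a x) + fderiv ℝ (P.D i) a (x - a) := by
      simp only [linearization]; abel
    have h5 := norm_add_le (P.D i x - linearization (P.D i) a x) (fderiv ℝ (P.D i) a (x - a))
    rw [← e] at h5
    rw [add_sub_add_comm, add_sub_add_comm]
    have h6 := norm_add₃_le (a := P.B i x - P.B i a) (b := P.C i x - P.C i a)
      (c := P.D i x - P.D i a)
    linarith
  · exact h ξ _ ((P.mem_T_iff i _ _).2 (by simpa using hη))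

end IsRegular

variable [∀ i, CompleteSpace (H i)] (P : Problem H)

lemma extendDual_last (w : ∀ i : Fin m, H i.castSucc) :
    P.extendDual w (Fin.last m) = P.lastDual w := by
  simp [extendDual]

lemma extendDual_castSucc (w : ∀ i : Fin m, H i.castSucc) (i : Fin m) :
    P.extendDual w i.castSucc = w i := by
  simp [extendDual]

lemma extendDual_eq {w : ∀ i, H i}
    (hw : w (Fin.last m) = P.lastDual fun i => w i.castSucc) :
    P.extendDual (fun i => w i.castSucc) = w := by
  funext i
  refine Fin.lastCases ?_ (fun j => ?_) i
  · rw [extendDual_last, hw]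
  · rw [extendDual_castSucc]

lemma sum_adjoint_extendDual (hG : P.G (Fin.last m) = ContinuousLinearMap.id ℝ _)
    (w : ∀ i : Fin m, H i.castSucc) :
    ∑ i, ContinuousLinearMap.adjoint (P.G i) (P.extendDual w i) = 0 := by
  rw [Fin.sum_univ_castSucc]
  simp only [extendDual_castSucc, extendDual_last, hG]
  rw [← ContinuousLinearMap.one_def, ← ContinuousLinearMap.star_eq_adjoint, star_one]
  simp [lastDual]

/-- The adjoints carry the pairing to `z` against `∑ G_i^* w_i`, which vanishes by the choice of
`w_n`. -/
lemma sum_inner_extendDual (hG : P.G (Fin.last m) = ContinuousLinearMap.id ℝ _)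
    (w : ∀ i : Fin m, H i.castSucc) (z : H (Fin.last m)) :
    ∑ i, inner ℝ (P.G i z) (P.extendDual w i) = 0 := by
  simp only [← ContinuousLinearMap.adjoint_inner_right]
  rw [← inner_sum, P.sum_adjoint_extendDual hG, inner_zero_right]

lemma mem_compositeOp_of_mem (hG : P.G (Fin.last m) = ContinuousLinearMap.id ℝ _)
    {p : ProductSpace H} (hp : p ∈ P.extendedSolutionSet) : 0 ∈ P.compositeOp p.1 := by
  rw [compositeOp, Set.mem_finsetSum]
  exact ⟨fun i => ContinuousLinearMap.adjoint (P.G i) (P.extendDual p.2 i),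
    fun {i} _ => ⟨_, hp i, rfl⟩, P.sum_adjoint_extendDual hG p.2⟩

lemma exists_mem_extendedSolutionSet (hG : P.G (Fin.last m) = ContinuousLinearMap.id ℝ _)
    {z : H (Fin.last m)} (hz : 0 ∈ P.compositeOp z) : ∃ p, p ∈ P.extendedSolutionSet := by
  rw [compositeOp, Set.mem_finsetSum] at hz
  obtain ⟨g, hg, hsum⟩ := hz
  have hg' : ∀ i, ∃ w ∈ P.T i (P.G i z), ContinuousLinearMap.adjoint (P.G i) w = g i :=
    fun i => hg (Finset.mem_univ i)
  choose w hw hwg using hg'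
  have hlast : w (Fin.last m) = P.lastDual fun i => w i.castSucc := by
    have h1 := hwg (Fin.last m)
    rw [hG, ← ContinuousLinearMap.one_def, ← ContinuousLinearMap.star_eq_adjoint, star_one,
      one_apply_eq_self] at h1
    rw [Fin.sum_univ_castSucc, ← h1] at hsum
    simp only [← hwg] at hsum
    exact eq_neg_of_add_eq_zero_right hsum
  refine ⟨(z, fun i => w i.castSucc), fun i => ?_⟩
  change P.extendDual (fun i => w i.castSucc) i ∈ _
  rw [P.extendDual_eq hlast]
  exact hw i

/-- The linear part of the separator at `(z, w)`. -/
lemma linear_part_eq (hG : P.G (Fin.last m) = ContinuousLinearMap.id ℝ _) (s : Iterates H)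
    (k : ℕ) (z : H (Fin.last m)) (w : ∀ i : Fin m, H i.castSucc) :
    inner ℝ z (vVec P s k) + ∑ i : Fin m, inner ℝ (w i) (uVec P s k i.castSucc)
      = ∑ i, (inner ℝ (s.x k i) (s.y k i)
        - inner ℝ (s.x k i - P.G i z) (s.y k i - P.extendDual w i)) := by
  -- Orthogonality is used twice: at `z` it removes the terms `⟨G_i z, w_i⟩`, and at `x_n` it
  -- absorbs the `G_i x_n` inside `u_i`.
  have h0 := P.sum_inner_extendDual hG w z
  have h1 := P.sum_inner_extendDual hG w (s.x k (Fin.last m))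
  have e : ∀ i, inner ℝ (s.x k i) (s.y k i)
        - inner ℝ (s.x k i - P.G i z) (s.y k i - P.extendDual w i)
      = inner ℝ (s.x k i) (P.extendDual w i) + inner ℝ (P.G i z) (s.y k i)
        - inner ℝ (P.G i z) (P.extendDual w i) := by
    intro i
    simp only [inner_sub_left, inner_sub_right]
    ring
  simp only [e]
  rw [Finset.sum_sub_distrib, h0, sub_zero, Finset.sum_add_distrib]
  rw [Fin.sum_univ_castSucc] at h1 ⊢
  rw [Fin.sum_univ_castSucc]
  simp only [extendDual_castSucc, hG, ContinuousLinearMap.id_apply, uVec, vVec, inner_add_right,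
    inner_sum, ContinuousLinearMap.adjoint_inner_right, inner_sub_right,
    Finset.sum_sub_distrib] at h1 ⊢
  have c1 : ∀ i : Fin m, inner ℝ (w i) (s.x k i.castSucc) = inner ℝ (s.x k i.castSucc) (w i) :=
    fun i => real_inner_comm _ _
  have c2 : ∀ i : Fin m, inner ℝ (w i) (P.G i.castSucc (s.x k (Fin.last m)))
    = inner ℝ (P.G i.castSucc (s.x k (Fin.last m))) (w i) := fun i => real_inner_comm _ _
  simp only [c1, c2]
  linarith

/-- The contribution of block `i` to `φ_k`. -/
def blockVal (P : Problem H) (s : Iterates H) (k : ℕ) (i : Fin (m + 1)) : ℝ :=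
  inner ℝ (P.G i (s.z k) - s.x k i) (s.y k i - s.w k i)
    - P.quarterInvBeta i * ‖s.x k i - P.G i (s.z k)‖ ^ 2

/-- Taking the current iterate in `linear_part_eq` cancels the `⟨x_i, y_i⟩`, so each block can be
estimated from its own step alone. -/
lemma phiVal_eq_sum (hG : P.G (Fin.last m) = ContinuousLinearMap.id ℝ _) {s : Iterates H}
    {k : ℕ} (hw : s.w k (Fin.last m) = P.lastDual fun i => s.w k i.castSucc) :
    phiVal P s k = ∑ i, P.blockVal s k i := by
  rw [phiVal, P.linear_part_eq hG s k (s.z k) (fun i => s.w k i.castSucc), P.extendDual_eq hw,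
    ← Finset.sum_sub_distrib]
  refine Finset.sum_congr rfl fun i _ => ?_
  rw [blockVal, ← neg_sub (s.x k i), inner_neg_left]
  ring

end Problem

/-! ### Separation and Fejér monotonicity. -/

section Run

variable {P : Problem H} {q : Params} {s : Iterates H}

lemma NewtonStep.mem_A {k : ℕ} {i : Fin (m + 1)} (h : NewtonStep P q s k i) :
    (s.ρ k i)⁻¹ • (P.G i (s.z k) - s.x k i) + s.w k i
      - (P.B i (P.G i (s.z k)) + P.C i (P.G i (s.z k)))
      - linearization (P.D i) (P.G i (s.z k)) (s.x k i) ∈ P.A i (s.x k i) := by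
  obtain ⟨α, hα, _, rfl, h'⟩ := inv_smul_sub_mem_of_mem_resolventOp h.1.ne' h.2.1
  have h2 : α + linearization (P.D i) (P.G i (s.z k)) (s.x k i)
    = (s.ρ k i)⁻¹ • (forwardPoint P s k i - s.x k i) := h'
  rw [forwardPoint, inv_smul_forward_sub h.1.ne'] at h2
  rw [← h2, add_sub_cancel_right]
  exact hα

lemma HalfForwardStep.mem_A {k : ℕ} {i : Fin (m + 1)} (h : HalfForwardStep P s k i) :
    (s.ρ k i)⁻¹ • (P.G i (s.z k) - s.x k i) + s.w k i
      - (P.B i (P.G i (s.z k)) + P.C i (P.G i (s.z k))) ∈ P.A i (s.x k i) := by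
  have := inv_smul_sub_mem_of_mem_resolventOp h.1.ne' h.2.1
  rwa [forwardPoint, inv_smul_forward_sub h.1.ne'] at this

lemma Problem.IsRegular.uVec_eq (hP : P.IsRegular) (k : ℕ) (i : Fin (m + 1)) :
    uVec P s k i = (s.x k i - P.G i (s.z k))
      - P.G i (s.x k (Fin.last m) - P.G (Fin.last m) (s.z k)) := by
  rw [uVec, hP.G_last, map_sub]
  simp

variable [∀ i, CompleteSpace (H i)]

namespace IsRun

/-- In every case of the algorithm, `y_i^k` belongs to
`(A_i + B_i + D_i)(x_i^k) + C_i(G_i z^k)`. -/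
lemma y_mem (hs : IsRun P q s) (hP : P.IsRegular) (k : ℕ) (i : Fin (m + 1)) :
    s.y k i - P.C i (P.G i (s.z k)) + P.C i (s.x k i) ∈ P.T i (s.x k i) := by
  rw [P.mem_T_iff]
  by_cases ht : s.w k i ∈ P.T i (P.G i (s.z k))
  · obtain ⟨-, hx, hy⟩ := hs.step_trivial k i ht
    rw [hx, hy, sub_add_cancel]
    exact (P.mem_T_iff i _ _).1 ht
  by_cases hi : i ∈ P.ID
  · have h := hs.step_newton k i ht hi
    convert h.mem_A using 1
    rw [h.2.2.1]
    abel
  · have h := hs.step_half_forward k i ht hi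
    convert h.mem_A using 1
    rw [h.2.2, hP.D_eq_zero i hi]
    abel

/-- Each block of the separator is nonpositive at a solution. -/
lemma block_le (hs : IsRun P q s) (hP : P.IsRegular) (k : ℕ) (i : Fin (m + 1)) {z : H (Fin.last m)}
    {w : H i} (hw : w ∈ P.T i (P.G i z)) :
    0 ≤ inner ℝ (s.x k i - P.G i z) (s.y k i - w)
      + P.quarterInvBeta i * ‖s.x k i - P.G i (s.z k)‖ ^ 2 := by
  have hy := hs.y_mem hP k i
  rw [P.mem_T_iff] at hy hw
  have h1 := (hP.maximal i).1 hy hw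
  have h2 := hP.monotone_B i (s.x k i) (P.G i z)
  have h3 := hP.monotone_D i (s.x k i) (P.G i z)
  have h4 := (hP.cocoercive i).inner_ge (hP.β_pos i) (s.x k i) (P.G i (s.z k)) (P.G i z)
  rw [← P.quarterInvBeta_eq] at h4
  set d := s.x k i - P.G i z
  -- The increments of `A`, `B` and `D` pair nonnegatively with `d`; only `C`, frozen at `G_i z^k`,
  -- costs the quadratic term.
  have e : s.y k i - w = (s.y k i - P.C i (P.G i (s.z k)) + P.C i (s.x k i)
      - (P.B i (s.x k i) + P.C i (s.x k i) + P.D i (s.x k i))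
      - (w - (P.B i (P.G i z) + P.C i (P.G i z) + P.D i (P.G i z))))
      + (P.B i (s.x k i) - P.B i (P.G i z)) + (P.D i (s.x k i) - P.D i (P.G i z))
      + (P.C i (P.G i (s.z k)) - P.C i (P.G i z)) := by abel
  rw [e, inner_add_right, inner_add_right, inner_add_right]
  linarith

/-- `φ_k` is bounded above by the decrease rate of the distance to a solution. -/
lemma phiVal_le (hs : IsRun P q s) (hP : P.IsRegular) (k : ℕ) {p : ProductSpace H}
    (hp : p ∈ P.extendedSolutionSet) :
    phiVal P s k ≤ inner ℝ (s.z k - p.1) (vVec P s k)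
      + ∑ i : Fin m, inner ℝ (s.w k i.castSucc - p.2 i) (uVec P s k i.castSucc) := by
  have h1 := P.linear_part_eq hP.G_last s k p.1 p.2
  have h2 : inner ℝ p.1 (vVec P s k) + ∑ i : Fin m, inner ℝ (p.2 i) (uVec P s k i.castSucc)
      ≤ ∑ i, (inner ℝ (s.x k i) (s.y k i)
        + P.quarterInvBeta i * ‖s.x k i - P.G i (s.z k)‖ ^ 2) := by
    rw [h1]
    refine Finset.sum_le_sum fun i _ => ?_
    have := hs.block_le hP k i (hp i)
    linarith
  rw [phiVal]
  simp only [inner_sub_left, Finset.sum_sub_distrib]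
  linarith

lemma piVal_nonneg (hq : q.Admissible) (k : ℕ) : 0 ≤ piVal P q s k := by
  have h0 := hq.γ_pos
  have h1 : 0 ≤ ∑ i : Fin m, ‖uVec P s k i.castSucc‖ ^ 2 := Finset.sum_nonneg fun i _ => sq_nonneg _
  rw [piVal]
  positivity

/-- If `π_k = 0`, then `v` and all `u_i` vanish, and `phiVal_le` at a solution forces `φ_k ≤ 0`. -/
lemma piVal_pos (hs : IsRun P q s) (hP : P.IsRegular) (hq : q.Admissible) {p : ProductSpace H}
    (hp : p ∈ P.extendedSolutionSet) {k : ℕ} (hφ : 0 < phiVal P s k) : 0 < piVal P q s k := by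
  refine (piVal_nonneg hq k).lt_of_ne fun h0 => ?_
  have hγ := hq.γ_pos
  have hsum : 0 ≤ ∑ i : Fin m, ‖uVec P s k i.castSucc‖ ^ 2 :=
    Finset.sum_nonneg fun i _ => sq_nonneg _
  have hv' : 0 ≤ q.γ⁻¹ * ‖vVec P s k‖ ^ 2 := by positivity
  rw [piVal] at h0
  have hv : vVec P s k = 0 := by
    have : q.γ⁻¹ * ‖vVec P s k‖ ^ 2 = 0 := by linarith
    simpa [hγ.ne'] using this
  have hu : ∀ i : Fin m, uVec P s k i.castSucc = 0 := by
    have h1 : ∑ i : Fin m, ‖uVec P s k i.castSucc‖ ^ 2 = 0 := by linarith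
    intro i
    have := (Finset.sum_eq_zero_iff_of_nonneg fun i _ => sq_nonneg _).1 h1 i (Finset.mem_univ i)
    simpa using this
  have h2 := hs.phiVal_le hP k hp
  simp only [hv, hu, inner_zero_right, Finset.sum_const_zero, add_zero] at h2
  linarith

/-- Fejér monotonicity with respect to the extended solution set. -/
lemma fejer (hs : IsRun P q s) (hP : P.IsRegular) (hq : q.Admissible) {p : ProductSpace H}
    (hp : p ∈ P.extendedSolutionSet) {k : ℕ} (hφ : 0 < phiVal P s k) :
    gammaInner q.γ (s.point (k + 1) - p) (s.point (k + 1) - p)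
      ≤ gammaInner q.γ (s.point k - p) (s.point k - p)
        - q.τlo * (2 - q.τhi) * (phiVal P s k ^ 2 / piVal P q s k) := by
  obtain ⟨⟨hτ1, hτ2⟩, hz, hw⟩ := hs.update k hφ
  have hγ := hq.γ_pos
  have hπ := hs.piVal_pos hP hq hp hφ
  have hle := hs.phiVal_le hP k hp
  set φ := phiVal P s k
  set π := piVal P q s k with hπdef
  set α := alphaVal P q s k with hα
  set L := inner ℝ (s.z k - p.1) (vVec P s k)
      + ∑ i : Fin m, inner ℝ (s.w k i.castSucc - p.2 i) (uVec P s k i.castSucc) with hL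
  have hexp : gammaInner q.γ (s.point (k + 1) - p) (s.point (k + 1) - p)
      = gammaInner q.γ (s.point k - p) (s.point k - p) - 2 * α * L + α ^ 2 * π := by
    simp only [gammaInner_self, Prod.fst_sub, Prod.snd_sub, Pi.sub_apply, Iterates.point, hz, hw]
    have e1 : ‖s.z k - (q.γ⁻¹ * α) • vVec P s k - p.1‖ ^ 2
        = ‖s.z k - p.1‖ ^ 2 - 2 * (q.γ⁻¹ * α) * inner ℝ (s.z k - p.1) (vVec P s k)
          + (q.γ⁻¹ * α) ^ 2 * ‖vVec P s k‖ ^ 2 := by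
      rw [sub_right_comm, norm_sub_sq_real, real_inner_smul_right, norm_smul, mul_pow,
        Real.norm_eq_abs, sq_abs]
      ring
    have e2 : ∀ i : Fin m, ‖s.w k i.castSucc - α • uVec P s k i.castSucc - p.2 i‖ ^ 2
        = ‖s.w k i.castSucc - p.2 i‖ ^ 2
          - 2 * α * inner ℝ (s.w k i.castSucc - p.2 i) (uVec P s k i.castSucc)
          + α ^ 2 * ‖uVec P s k i.castSucc‖ ^ 2 := by
      intro i
      rw [sub_right_comm, norm_sub_sq_real, real_inner_smul_right, norm_smul, mul_pow,
        Real.norm_eq_abs, sq_abs]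
      ring
    simp only [e1, e2, Finset.sum_add_distrib, Finset.sum_sub_distrib, ← Finset.mul_sum]
    rw [hπdef, piVal, hL]
    field_simp
    ring
  have hα' : α = s.τ k * (φ / π) := rfl
  have hτ0 : 0 < s.τ k := hq.τlo_pos.trans_le hτ1
  have hα0 : 0 ≤ α := by rw [hα']; positivity
  -- Together with `φ ≤ L`, the decrease is at least `τ * (2 - τ) * φ ^ 2 / π`.
  have e3 : α ^ 2 * π = s.τ k ^ 2 * (φ ^ 2 / π) := by rw [hα']; field_simp
  have e4 : α * φ = s.τ k * (φ ^ 2 / π) := by rw [hα']; ring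
  have h5 : α * φ ≤ α * L := mul_le_mul_of_nonneg_left hle hα0
  have h6 : 0 ≤ φ ^ 2 / π := by positivity
  have h7 : q.τlo * (2 - q.τhi) ≤ s.τ k * (2 - s.τ k) := by
    have := hq.τhi_lt
    have a1 : q.τlo * (2 - q.τhi) ≤ s.τ k * (2 - q.τhi) :=
      mul_le_mul_of_nonneg_right hτ1 (by linarith)
    have a2 : s.τ k * (2 - q.τhi) ≤ s.τ k * (2 - s.τ k) :=
      mul_le_mul_of_nonneg_left (by linarith) hτ0.le
    linarith
  have h8 := mul_le_mul_of_nonneg_right h7 h6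
  rw [hexp, e3]
  linarith

lemma point_succ_of_not_pos (hs : IsRun P q s) {k : ℕ} (hφ : ¬ 0 < phiVal P s k) :
    s.point (k + 1) = s.point k := by
  obtain ⟨hz, hw⟩ := hs.stay k hφ
  exact Prod.ext hz (funext hw)

lemma antitone_dist (hs : IsRun P q s) (hP : P.IsRegular) (hq : q.Admissible) {p : ProductSpace H}
    (hp : p ∈ P.extendedSolutionSet) :
    Antitone fun k => gammaInner q.γ (s.point k - p) (s.point k - p) := by
  refine antitone_nat_of_succ_le fun k => ?_
  by_cases hφ : 0 < phiVal P s k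
  · have h := hs.fejer hP hq hp hφ
    have hπ := hs.piVal_pos hP hq hp hφ
    have h1 := hq.τlo_pos
    have h2 : 0 < 2 - q.τhi := by linarith [hq.τhi_lt]
    have h3 : 0 ≤ q.τlo * (2 - q.τhi) * (phiVal P s k ^ 2 / piVal P q s k) := by positivity
    linarith
  · rw [hs.point_succ_of_not_pos hφ]

lemma tendsto_dist (hs : IsRun P q s) (hP : P.IsRegular) (hq : q.Admissible) {p : ProductSpace H}
    (hp : p ∈ P.extendedSolutionSet) :
    ∃ d, Tendsto (fun k => gammaInner q.γ (s.point k - p) (s.point k - p)) atTop (𝓝 d) :=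
  ⟨_, tendsto_atTop_ciInf (hs.antitone_dist hP hq hp)
    ⟨0, by rintro _ ⟨k, rfl⟩; exact gammaInner_self_nonneg hq.γ_pos _⟩⟩

lemma exists_bound (hs : IsRun P q s) (hP : P.IsRegular) (hq : q.Admissible) {p : ProductSpace H}
    (hp : p ∈ P.extendedSolutionSet) :
    ∃ R, ∀ k, ‖s.z k‖ ≤ R ∧ ∀ i, ‖s.w k i‖ ≤ R := by
  set V := gammaInner q.γ (s.point 0 - p) (s.point 0 - p)
  have hγ := hq.γ_pos
  have hV : ∀ k, gammaInner q.γ (s.point k - p) (s.point k - p) ≤ V := fun k =>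
    hs.antitone_dist hP hq hp (Nat.zero_le k)
  have hz : ∀ k, ‖s.z k‖ ≤ ‖p.1‖ + Real.sqrt (V / q.γ) := by
    intro k
    have h1 := (norm_fst_sq_le (γ := q.γ) (s.point k - p)).trans (hV k)
    have h2 : ‖s.z k - p.1‖ ≤ Real.sqrt (V / q.γ) := by
      refine Real.le_sqrt_of_sq_le ?_
      rw [le_div_iff₀ hγ, mul_comm]
      exact h1
    have := norm_le_norm_add_norm_sub' (s.z k) p.1
    linarith
  have hw : ∀ k (i : Fin m), ‖s.w k i.castSucc‖ ≤ ‖p.2‖ + Real.sqrt V := by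
    intro k i
    have h1 := (norm_snd_sq_le hγ (s.point k - p) i).trans (hV k)
    have h2 : ‖s.w k i.castSucc - p.2 i‖ ≤ Real.sqrt V := Real.le_sqrt_of_sq_le h1
    have := norm_le_norm_add_norm_sub' (s.w k i.castSucc) (p.2 i)
    have := norm_le_pi_norm p.2 i
    linarith
  set R₁ := ‖p.1‖ + Real.sqrt (V / q.γ) with hR₁
  set R₂ := ‖p.2‖ + Real.sqrt V with hR₂
  set N := ∑ i : Fin m, ‖ContinuousLinearMap.adjoint (P.G i.castSucc)‖ with hN
  have hN0 : 0 ≤ N := Finset.sum_nonneg fun i _ => norm_nonneg _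
  have hR₁0 : 0 ≤ R₁ := by positivity
  have hR₂0 : 0 ≤ R₂ := by positivity
  have hNR : 0 ≤ N * R₂ := by positivity
  refine ⟨R₁ + R₂ + N * R₂, fun k => ⟨by linarith [hz k], fun i => ?_⟩⟩
  refine Fin.lastCases ?_ (fun j => by linarith [hw k j]) i
  rw [hs.dual_last k, Problem.lastDual, norm_neg]
  have : ‖∑ i : Fin m, ContinuousLinearMap.adjoint (P.G i.castSucc) (s.w k i.castSucc)‖
      ≤ N * R₂ := by
    rw [hN, Finset.sum_mul]
    refine norm_sum_le_of_le _ fun i _ => ?_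
    exact (ContinuousLinearMap.le_opNorm _ _).trans
      (mul_le_mul_of_nonneg_left (hw k i) (norm_nonneg _))
  linarith

end IsRun

end Run

end

section

variable {m : ℕ} {H : Fin (m + 1) → Type*}
  [∀ i, NormedAddCommGroup (H i)] [∀ i, InnerProductSpace ℝ (H i)] [∀ i, CompleteSpace (H i)]

/-! ### Weak closedness of the coupled graphs. -/

namespace Problem

/-- Weak closedness of the primal-dual relation: if `a` and `b` converge weakly to `z` and `w`, are
coupled through `∑ G_i^* b_i = 0`, and are strongly asymptotic to points of the graphs of the
`T_i`, then `(z, w)` lies in the graphs. -/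
lemma IsRegular.mem_T_of_weak_limit {P : Problem H} (hP : P.IsRegular) {l : Filter ℕ} [l.NeBot]
    {a b x y : ℕ → ∀ i, H i} {a₀ b₀ : ∀ i, H i} {R : ℝ}
    (ha : ∀ i, InnerTendsto (fun k => a k i) l (a₀ i))
    (hb : ∀ i, InnerTendsto (fun k => b k i) l (b₀ i))
    (hab : ∀ k, ∑ i, inner ℝ (a k i) (b k i) = 0) (hab₀ : ∑ i, inner ℝ (a₀ i) (b₀ i) = 0)
    (haR : ∀ k i, ‖a k i‖ ≤ R) (hbR : ∀ k i, ‖b k i‖ ≤ R)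
    (hx : ∀ i, Tendsto (fun k => x k i - a k i) l (𝓝 0))
    (hy : ∀ i, Tendsto (fun k => y k i - b k i) l (𝓝 0))
    (hmem : ∀ k i, y k i ∈ P.T i (x k i)) (i : Fin (m + 1)) : b₀ i ∈ P.T i (a₀ i) := by
  classical
  -- The pairings of two weakly convergent sequences need not converge. Here their sum is zero along
  -- the sequence and at the limit, so subtracting `⟨a_i, b_i⟩` from each block leaves only terms
  -- that pass to the limit.
  have key : ∀ ξ f : ∀ i, H i, (∀ i, f i ∈ P.T i (ξ i)) →
      0 ≤ ∑ i, inner ℝ (a₀ i - ξ i) (b₀ i - f i) := by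
    intro ξ f hf
    have hlim : ∀ i, Tendsto (fun k => inner ℝ (x k i - ξ i) (y k i - f i)
        - inner ℝ (a k i) (b k i)) l
        (𝓝 (inner ℝ (a₀ i - ξ i) (b₀ i - f i) - inner ℝ (a₀ i) (b₀ i))) := by
      intro i
      have t1 := tendsto_inner_zero_of_bounded (x := fun k => a k i - ξ i) (R := R + ‖ξ i‖)
        (fun k => (norm_sub_le _ _).trans (by linarith [haR k i])) (hy i)
      have t2 := tendsto_inner_zero_of_bounded (x := fun k => b k i - f i) (R := R + ‖f i‖)
        (fun k => (norm_sub_le _ _).trans (by linarith [hbR k i])) (hx i)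
      have t3 := (hx i).inner (𝕜 := ℝ) (hy i)
      rw [inner_zero_left] at t3
      have t4 := ((t1.add t2).add t3).add
        (((ha i (f i)).neg.sub (hb i (ξ i))).add_const (inner ℝ (ξ i) (f i)))
      refine (t4.congr fun k => ?_).trans_eq ?_
      · simp only [inner_sub_left, inner_sub_right]
        rw [real_inner_comm (a k i) (b k i), real_inner_comm (x k i) (b k i),
          real_inner_comm (a k i) (f i), real_inner_comm (x k i) (f i)]
        ring
      · congr 1
        simp only [inner_sub_left, inner_sub_right]
        rw [real_inner_comm (a₀ i) (f i)]
        ring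
    have hsum := tendsto_finsetSum Finset.univ fun i _ => hlim i
    have h0 : 0 ≤ ∑ i, (inner ℝ (a₀ i - ξ i) (b₀ i - f i) - inner ℝ (a₀ i) (b₀ i)) := by
      refine ge_of_tendsto hsum (Eventually.of_forall fun k => ?_)
      rw [Finset.sum_sub_distrib, hab, sub_zero]
      exact Finset.sum_nonneg fun i _ => hP.monotone_T i (hmem k i) (hf i)
    rwa [Finset.sum_sub_distrib, hab₀, sub_zero] at h0
  -- Otherwise `(a₀ j, b₀ j)` would be strictly related to the whole graph, hence in it, hence
  -- strictly related to itself. Using such pairs in all blocks but `i` isolates block `i` in `key`.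
  have hpair : ∀ j, ∃ ξ f, f ∈ P.T j ξ ∧ inner ℝ (a₀ j - ξ) (b₀ j - f) ≤ 0 := by
    intro j
    by_contra! h
    have := h _ _ (hP.mem_T_of_related fun ξ f hf => (h ξ f hf).le)
    simp at this
  choose ξ f hf hle using hpair
  refine hP.mem_T_of_related fun η g hg => ?_
  have h1 := key (Function.update ξ i η) (Function.update f i g) (fun j => by
    rcases eq_or_ne j i with rfl | hj
    · simpa using hg
    · simpa [hj] using hf j)
  rw [← Finset.add_sum_erase _ _ (Finset.mem_univ i)] at h1
  have h2 : ∑ j ∈ Finset.univ.erase i, inner ℝ (a₀ j - Function.update ξ i η j)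
      (b₀ j - Function.update f i g j) ≤ 0 := by
    refine Finset.sum_nonpos fun j hj => ?_
    have hji := Finset.ne_of_mem_erase hj
    simpa [hji] using hle j
  simp only [Function.update_self] at h1
  linarith

end Problem

/-! ### Vanishing gaps and weak convergence of the run. -/

namespace IsRun

variable {P : Problem H} {q : Params} {s : Iterates H}

/-- The step size requirement for the blocks outside `I_D`. -/
def StepSizesBounded (P : Problem H) (s : Iterates H) : Prop :=
  ∀ i ∉ P.ID, ∃ ρlo ρhi : ℝ, 0 < ρlo ∧
    ENNReal.ofReal ρhi < ((4 * P.β i)⁻¹ + (P.lipB i : ℝ≥0∞))⁻¹ ∧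
    ∀ k, s.w k i ∉ P.T i (P.G i (s.z k)) → ρlo ≤ s.ρ k i ∧ s.ρ k i ≤ ρhi

lemma exists_block_bound (hs : IsRun P q s) (hP : P.IsRegular) (hq : q.Admissible)
    (hρ : StepSizesBounded P s) {R : ℝ} (hR : ∀ k, ‖s.z k‖ ≤ R ∧ ∀ i, ‖s.w k i‖ ≤ R)
    (i : Fin (m + 1)) :
    ∃ K : ℝ, 0 < K ∧ ∀ k, ‖s.x k i - P.G i (s.z k)‖ ^ 2 ≤ K * P.blockVal s k i ∧
      ‖s.y k i - s.w k i‖ ≤ K * ‖s.x k i - P.G i (s.z k)‖ := by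
  have hκ0 : 0 ≤ P.quarterInvBeta i := ENNReal.toReal_nonneg
  have htriv : ∀ (K : ℝ) k, s.w k i ∈ P.T i (P.G i (s.z k)) →
      ‖s.x k i - P.G i (s.z k)‖ ^ 2 ≤ K * P.blockVal s k i ∧
      ‖s.y k i - s.w k i‖ ≤ K * ‖s.x k i - P.G i (s.z k)‖ := by
    intro K k ht
    obtain ⟨-, hx, hy⟩ := hs.step_trivial k i ht
    simp [Problem.blockVal, hx, hy]
  by_cases hi : i ∈ P.ID
  · obtain ⟨x', η, hη⟩ := (hP.maximal i).exists_mem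
    have hR0 : 0 ≤ R := (norm_nonneg _).trans (hR 0).1
    obtain ⟨K, hK, h⟩ := exists_newton_bound (hP.maximal i).1 (hP.lipschitz_B i) (hP.β_pos i)
      (hP.cocoercive i) (hP.monotone_D i) (hP.contDiff_D i) (hP.lipschitz_fderiv_D i) hη
      -- One radius that bounds both `G_i z^k - x'` and `w_i^k`.
      hq.δhat_pos hq.θlo_pos hq.θhi_lt (R := ‖P.G i‖ * R + ‖x'‖ + R)
    refine ⟨K, hK, fun k => ?_⟩
    by_cases ht : s.w k i ∈ P.T i (P.G i (s.z k))
    · exact htriv K k ht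
    have hN := hs.step_newton k i ht hi
    have hGR : ‖P.G i‖ * ‖s.z k‖ ≤ ‖P.G i‖ * R :=
      mul_le_mul_of_nonneg_left (hR k).1 (norm_nonneg _)
    have hGR0 : 0 ≤ ‖P.G i‖ * R := by positivity
    have := h (P.G i (s.z k)) (s.w k i) (s.x k i) (s.y k i) (s.ρ k i)
      ((norm_sub_le _ _).trans (by linarith [(P.G i).le_opNorm (s.z k)]))
      (by linarith [(hR k).2 i, norm_nonneg x']) hN.1 hN.mem_A hN.2.2.1 hN.2.2.2
    rwa [← P.quarterInvBeta_eq] at this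
  · obtain ⟨ρlo, ρhi, h0, h1, h2⟩ := hρ i hi
    obtain ⟨K, hK, h⟩ := exists_half_forward_bound (hP.lipschitz_B i) h0
      (P.mul_quarterInvBeta_add_lt_one (hP.β_pos i) h1)
    refine ⟨K, hK, fun k => ?_⟩
    by_cases ht : s.w k i ∈ P.T i (P.G i (s.z k))
    · exact htriv K k ht
    exact h _ _ _ _ _ (h2 k ht).1 (h2 k ht).2 hκ0 (hs.step_half_forward k i ht hi).2.2

/-- Block estimates with a constant that is uniform in the block. -/
lemma exists_uniform_block_bound (hs : IsRun P q s) (hP : P.IsRegular) (hq : q.Admissible)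
    (hρ : StepSizesBounded P s) {R : ℝ} (hR : ∀ k, ‖s.z k‖ ≤ R ∧ ∀ i, ‖s.w k i‖ ≤ R) :
    ∃ K : ℝ, 0 < K ∧ ∀ k i, 0 ≤ P.blockVal s k i ∧
      ‖s.x k i - P.G i (s.z k)‖ ^ 2 ≤ K * P.blockVal s k i ∧
      ‖s.y k i - s.w k i‖ ≤ K * ‖s.x k i - P.G i (s.z k)‖ := by
  choose K hK h using fun i => hs.exists_block_bound hP hq hρ hR i
  have hle : ∀ i, K i ≤ ∑ j, K j := fun i =>
    Finset.single_le_sum (fun j _ => (hK j).le) (Finset.mem_univ i)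
  refine ⟨∑ i, K i, Finset.sum_pos (fun i _ => hK i) Finset.univ_nonempty, fun k i => ?_⟩
  obtain ⟨h1, h2⟩ := h i k
  have h0 : 0 ≤ P.blockVal s k i :=
    (mul_nonneg_iff_of_pos_left (hK i)).1 ((sq_nonneg _).trans h1)
  exact ⟨h0, h1.trans (mul_le_mul_of_nonneg_right (hle i) h0),
    h2.trans (mul_le_mul_of_nonneg_right (hle i) (norm_nonneg _))⟩

/-- Since `∑ G_i^* w_i^k = 0`, subtracting it shows that `v^k` is controlled by the dual gaps. -/
lemma vVec_eq (hs : IsRun P q s) (hP : P.IsRegular) (k : ℕ) :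
    vVec P s k = ∑ i, ContinuousLinearMap.adjoint (P.G i) (s.y k i - s.w k i) := by
  have h1 := P.sum_adjoint_extendDual hP.G_last fun i => s.w k i.castSucc
  rw [P.extendDual_eq (hs.dual_last k)] at h1
  simp only [map_sub, Finset.sum_sub_distrib, h1, sub_zero]
  rw [Fin.sum_univ_castSucc, hP.G_last, ← ContinuousLinearMap.one_def,
    ← ContinuousLinearMap.star_eq_adjoint, star_one]
  rfl

/-- The squared gradient norm of the separator is controlled by its value. -/
lemma exists_piVal_le (hs : IsRun P q s) (hP : P.IsRegular) (hq : q.Admissible)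
    (hρ : StepSizesBounded P s) {R : ℝ} (hR : ∀ k, ‖s.z k‖ ≤ R ∧ ∀ i, ‖s.w k i‖ ≤ R) :
    ∃ K : ℝ, 0 < K ∧ ∀ k, piVal P q s k ≤ K * phiVal P s k := by
  obtain ⟨K, hK, h⟩ := hs.exists_uniform_block_bound hP hq hρ hR
  have hγ := hq.γ_pos
  set N := ∑ i, ‖P.G i‖ with hN
  have hN0 : 0 ≤ N := Finset.sum_nonneg fun i _ => norm_nonneg _
  have hNi : ∀ i, ‖P.G i‖ ≤ N := fun i =>
    Finset.single_le_sum (f := fun i => ‖P.G i‖) (fun j _ => norm_nonneg _) (Finset.mem_univ i)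
  -- With `S` the sum of the primal gaps, `‖v‖ ≤ N * K * S` and each of the `m` vectors `u_i` has
  -- norm at most `(1 + N) * S`, so `π ≤ M * S ^ 2`. Cauchy–Schwarz over `m + 1` blocks bounds `S ^
  -- 2`; the final `+ 1` only ensures positivity.
  set M := q.γ⁻¹ * (N * K) ^ 2 + m * (1 + N) ^ 2 with hM
  refine ⟨M * ((m + 1) * K) + 1, by positivity, fun k => ?_⟩
  set r : Fin (m + 1) → ℝ := fun i => ‖s.x k i - P.G i (s.z k)‖ with hr
  set S := ∑ i, r i with hS
  have hri : ∀ i, r i ≤ S := fun i =>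
    Finset.single_le_sum (f := r) (fun j _ => norm_nonneg _) (Finset.mem_univ i)
  have hS0 : 0 ≤ S := Finset.sum_nonneg fun i _ => norm_nonneg _
  have hv : ‖vVec P s k‖ ≤ N * K * S := by
    rw [hs.vVec_eq hP, hS, Finset.mul_sum]
    refine norm_sum_le_of_le _ fun i _ => ?_
    refine (ContinuousLinearMap.le_opNorm _ _).trans ?_
    rw [LinearIsometryEquiv.norm_map, mul_assoc]
    exact mul_le_mul (hNi i) (h k i).2.2 (norm_nonneg _) hN0
  have hu : ∀ i, ‖uVec P s k i‖ ≤ (1 + N) * S := by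
    intro i
    rw [hP.uVec_eq]
    have h1 := norm_sub_le (s.x k i - P.G i (s.z k))
      (P.G i (s.x k (Fin.last m) - P.G (Fin.last m) (s.z k)))
    have h2 := (P.G i).le_opNorm (s.x k (Fin.last m) - P.G (Fin.last m) (s.z k))
    have h3 := mul_le_mul (hNi i) (hri (Fin.last m)) (norm_nonneg _) hN0
    have h4 := hri i
    simp only [hr] at h3 h4
    linarith
  have hφ : phiVal P s k = ∑ i, P.blockVal s k i := P.phiVal_eq_sum hP.G_last (hs.dual_last k)
  have hφ0 : 0 ≤ phiVal P s k := by
    rw [hφ]; exact Finset.sum_nonneg fun i _ => (h k i).1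
  have hS2 : S ^ 2 ≤ (m + 1) * K * phiVal P s k := by
    have h1 := sq_sum_le_card_mul_sum_sq (s := Finset.univ) (f := r)
    rw [Finset.card_univ, Fintype.card_fin] at h1
    have h2 : ∑ i, r i ^ 2 ≤ K * phiVal P s k := by
      rw [hφ, Finset.mul_sum]
      exact Finset.sum_le_sum fun i _ => (h k i).2.1
    have h3 : ((m + 1 : ℕ) : ℝ) * ∑ i, r i ^ 2 ≤ ((m + 1 : ℕ) : ℝ) * (K * phiVal P s k) :=
      mul_le_mul_of_nonneg_left h2 (by positivity)
    push_cast at h1 h3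
    linarith
  have hπ : piVal P q s k ≤ M * S ^ 2 := by
    rw [piVal]
    have h1 : ‖vVec P s k‖ ^ 2 ≤ (N * K * S) ^ 2 := pow_le_pow_left₀ (norm_nonneg _) hv 2
    have h2 : ∑ i : Fin m, ‖uVec P s k i.castSucc‖ ^ 2 ≤ m * ((1 + N) * S) ^ 2 := by
      have := Finset.sum_le_card_nsmul Finset.univ (fun i : Fin m => ‖uVec P s k i.castSucc‖ ^ 2)
        (((1 + N) * S) ^ 2) fun i _ => pow_le_pow_left₀ (norm_nonneg _) (hu _) 2
      simpa using this
    have h3 := mul_le_mul_of_nonneg_left h1 (inv_pos.2 hγ).le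
    rw [hM]
    linarith
  have hM0 : 0 ≤ M := by positivity
  have := mul_le_mul_of_nonneg_left hS2 hM0
  linarith

/-- From `π ≤ K φ` follows `φ ≤ K φ ^ 2 / π` when `φ > 0`, so `φ_k` is at most a multiple of the
successive decrease of a convergent sequence of squared distances. -/
lemma tendsto_phiVal (hs : IsRun P q s) (hP : P.IsRegular) (hq : q.Admissible)
    (hρ : StepSizesBounded P s) {p : ProductSpace H} (hp : p ∈ P.extendedSolutionSet) :
    Tendsto (fun k => phiVal P s k) atTop (𝓝 0) := by
  obtain ⟨R, hR⟩ := hs.exists_bound hP hq hp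
  obtain ⟨K, hK, hπ⟩ := hs.exists_piVal_le hP hq hρ hR
  obtain ⟨K', -, hb⟩ := hs.exists_uniform_block_bound hP hq hρ hR
  obtain ⟨d, hd⟩ := hs.tendsto_dist hP hq hp
  have hφ0 : ∀ k, 0 ≤ phiVal P s k := fun k => by
    rw [P.phiVal_eq_sum hP.G_last (hs.dual_last k)]
    exact Finset.sum_nonneg fun i _ => (hb k i).1
  set c := q.τlo * (2 - q.τhi) with hc
  have hc0 : 0 < c := mul_pos hq.τlo_pos (by linarith [hq.τhi_lt])
  have hdiff : Tendsto (fun k => K / c * (gammaInner q.γ (s.point k - p) (s.point k - p)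
      - gammaInner q.γ (s.point (k + 1) - p) (s.point (k + 1) - p))) atTop (𝓝 0) := by
    have := (hd.sub (hd.comp (tendsto_add_atTop_nat 1))).const_mul (K / c)
    rwa [sub_self, mul_zero] at this
  refine squeeze_zero hφ0 (fun k => ?_) hdiff
  by_cases hφ : 0 < phiVal P s k
  · have h1 := hs.fejer hP hq hp hφ
    have h2 := hs.piVal_pos hP hq hp hφ
    have h3 := hπ k
    have h4 : phiVal P s k ≤ K * (phiVal P s k ^ 2 / piVal P q s k) := by
      rw [mul_div_assoc', le_div_iff₀ h2]
      have := mul_le_mul_of_nonneg_left h3 hφ.le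
      linarith
    rw [div_mul_eq_mul_div, le_div_iff₀ hc0]
    have h5 := mul_le_mul_of_nonneg_left h4 hc0.le
    have h6 := mul_le_mul_of_nonneg_left h1 hK.le
    rw [← hc] at h6
    linarith
  · rw [hs.point_succ_of_not_pos hφ, sub_self, mul_zero]
    exact not_lt.1 hφ

lemma tendsto_sub_zero (hs : IsRun P q s) (hP : P.IsRegular) (hq : q.Admissible)
    (hρ : StepSizesBounded P s) {p : ProductSpace H} (hp : p ∈ P.extendedSolutionSet)
    (i : Fin (m + 1)) :
    Tendsto (fun k => s.x k i - P.G i (s.z k)) atTop (𝓝 0) ∧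
      Tendsto (fun k => s.y k i - s.w k i) atTop (𝓝 0) := by
  obtain ⟨R, hR⟩ := hs.exists_bound hP hq hp
  obtain ⟨K, hK, hb⟩ := hs.exists_uniform_block_bound hP hq hρ hR
  have hφ := hs.tendsto_phiVal hP hq hρ hp
  have hx : Tendsto (fun k => ‖s.x k i - P.G i (s.z k)‖) atTop (𝓝 0) := by
    have h1 : Tendsto (fun k => Real.sqrt (K * phiVal P s k)) atTop (𝓝 0) := by
      simpa using (hφ.const_mul K).sqrt
    refine squeeze_zero (fun k => norm_nonneg _) (fun k => Real.le_sqrt_of_sq_le ?_) h1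
    refine (hb k i).2.1.trans (mul_le_mul_of_nonneg_left ?_ hK.le)
    rw [P.phiVal_eq_sum hP.G_last (hs.dual_last k)]
    exact Finset.single_le_sum (fun j _ => (hb k j).1) (Finset.mem_univ i)
  refine ⟨tendsto_zero_iff_norm_tendsto_zero.2 hx, tendsto_zero_iff_norm_tendsto_zero.2 ?_⟩
  refine squeeze_zero (fun k => norm_nonneg _) (fun k => (hb k i).2.2) ?_
  simpa using hx.const_mul K

/-- `w_n` converges weakly together with `w_1, …, w_{n-1}`. -/
lemma innerTendsto_w (hs : IsRun P q s) {l : Filter ℕ} {w : ∀ i : Fin m, H i.castSucc}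
    (hw : ∀ i : Fin m, InnerTendsto (fun k => s.w k i.castSucc) l (w i)) (i : Fin (m + 1)) :
    InnerTendsto (fun k => s.w k i) l (P.extendDual w i) := by
  refine Fin.lastCases ?_ (fun j => ?_) i
  · simp only [hs.dual_last, P.extendDual_last, Problem.lastDual]
    intro r
    simp only [inner_neg_right, inner_sum]
    exact (tendsto_finsetSum _ fun j _ => (hw j).map _ r).neg
  · simp only [P.extendDual_castSucc]
    exact hw j

/-- Every weak cluster point of the iterates lies in the extended solution set. -/
lemma mem_extendedSolutionSet_of_innerTendsto (hs : IsRun P q s) (hP : P.IsRegular)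
    (hq : q.Admissible) (hρ : StepSizesBounded P s) {p p₀ : ProductSpace H}
    (hp : p ∈ P.extendedSolutionSet) {l : Filter ℕ} [l.NeBot] (hl : l ≤ atTop)
    (hz : InnerTendsto s.z l p₀.1)
    (hw : ∀ i : Fin m, InnerTendsto (fun k => s.w k i.castSucc) l (p₀.2 i)) :
    p₀ ∈ P.extendedSolutionSet := by
  obtain ⟨R, hR⟩ := hs.exists_bound hP hq hp
  have hR0 : 0 ≤ R := (norm_nonneg _).trans (hR 0).1
  have hN0 : 0 ≤ ∑ i, ‖P.G i‖ := Finset.sum_nonneg fun i _ => norm_nonneg _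
  have hx : ∀ i, Tendsto (fun k => s.x k i - P.G i (s.z k)) l (𝓝 0) := fun i =>
    (hs.tendsto_sub_zero hP hq hρ hp i).1.mono_left hl
  have hy : ∀ i, Tendsto (fun k => s.y k i - s.w k i) l (𝓝 0) := fun i =>
    (hs.tendsto_sub_zero hP hq hρ hp i).2.mono_left hl
  have hC : ∀ i, Tendsto (fun k => P.C i (s.x k i) - P.C i (P.G i (s.z k))) l (𝓝 0) := by
    intro i
    refine tendsto_zero_iff_norm_tendsto_zero.2 ?_
    refine squeeze_zero (fun k => norm_nonneg _)
      (fun k => (hP.cocoercive i).norm_sub_le (hP.β_pos i) _ _) ?_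
    simpa using (hx i).norm.const_mul ((P.β i)⁻¹).toReal
  -- The dual points are corrected by `C(x) - C(G z)` to lie in `T_i(x_i)`; the correction vanishes
  -- by `hC`.
  refine hP.mem_T_of_weak_limit (l := l) (a := fun k i => P.G i (s.z k)) (b := s.w) (x := s.x)
    (a₀ := fun i => P.G i p₀.1) (b₀ := P.extendDual p₀.2)
    (y := fun k i => s.y k i - P.C i (P.G i (s.z k)) + P.C i (s.x k i))
    (R := (∑ i, ‖P.G i‖) * R + R) (fun i => hz.map (P.G i)) (hs.innerTendsto_w hw) (fun k => ?_)
    (P.sum_inner_extendDual hP.G_last _ _) (fun k i => ?_) (fun k i => ?_) hx (fun i => ?_)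
    (fun k i => hs.y_mem hP k i)
  · have := P.sum_inner_extendDual hP.G_last (fun i => s.w k i.castSucc) (s.z k)
    rwa [P.extendDual_eq (hs.dual_last k)] at this
  · have h1 : ‖P.G i‖ ≤ ∑ i, ‖P.G i‖ :=
      Finset.single_le_sum (f := fun i => ‖P.G i‖) (fun j _ => norm_nonneg _) (Finset.mem_univ i)
    have h2 := mul_le_mul h1 (hR k).1 (norm_nonneg _) hN0
    linarith [(P.G i).le_opNorm (s.z k)]
  · have := (hR k).2 i
    have : 0 ≤ (∑ i, ‖P.G i‖) * R := by positivity
    linarith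
  · have := (hy i).add (hC i)
    rw [add_zero] at this
    refine this.congr fun k => ?_
    abel

lemma exists_ultrafilter_limit (hs : IsRun P q s) (hP : P.IsRegular)
    (hq : q.Admissible) (hρ : StepSizesBounded P s) {p : ProductSpace H}
    (hp : p ∈ P.extendedSolutionSet) (U : Ultrafilter ℕ) (hU : (U : Filter ℕ) ≤ atTop) :
    ∃ p₀ ∈ P.extendedSolutionSet, InnerTendsto s.z U p₀.1 ∧
      ∀ i : Fin m, InnerTendsto (fun k => s.w k i.castSucc) U (p₀.2 i) := by
  obtain ⟨R, hR⟩ := hs.exists_bound hP hq hp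
  obtain ⟨z, hz⟩ := exists_weak_limit_ultrafilter (fun k => (hR k).1) U
  choose w hw using fun i : Fin m =>
    exists_weak_limit_ultrafilter (fun k => (hR k).2 i.castSucc) U
  exact ⟨(z, w), hs.mem_extendedSolutionSet_of_innerTendsto hP hq hρ hp hU hz hw, hz, hw⟩

/-- Weak convergence of the iterates to a point of the extended solution set. -/
lemma exists_innerTendsto (hs : IsRun P q s) (hP : P.IsRegular)
    (hq : q.Admissible) (hρ : StepSizesBounded P s) {p : ProductSpace H}
    (hp : p ∈ P.extendedSolutionSet) :
    ∃ p₀ ∈ P.extendedSolutionSet, InnerTendsto s.z atTop p₀.1 ∧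
      ∀ i : Fin m, InnerTendsto (fun k => s.w k i.castSucc) atTop (p₀.2 i) := by
  obtain ⟨p₀, hp₀, hz₀, hw₀⟩ :=
    hs.exists_ultrafilter_limit hP hq hρ hp (Ultrafilter.of atTop) (Ultrafilter.of_le atTop)
  -- Opial's argument identifies the limits along all ultrafilters below `atTop`, which amounts to
  -- convergence along `atTop`.
  have hall : ∀ U : Ultrafilter ℕ, (U : Filter ℕ) ≤ atTop → InnerTendsto s.z U p₀.1 ∧
      ∀ i : Fin m, InnerTendsto (fun k => s.w k i.castSucc) U (p₀.2 i) := by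
    intro U hU
    obtain ⟨p₁, hp₁, hz₁, hw₁⟩ := hs.exists_ultrafilter_limit hP hq hρ hp U hU
    obtain ⟨d₀, hd₀⟩ := hs.tendsto_dist hP hq hp₀
    obtain ⟨d₁, hd₁⟩ := hs.tendsto_dist hP hq hp₁
    have : p₀ = p₁ := eq_of_tendsto_dist hq.γ_pos (Ultrafilter.of_le atTop) hU
      (tendsto_gammaInner (p := s.point) hz₀ hw₀) (tendsto_gammaInner (p := s.point) hz₁ hw₁)
      hd₀ hd₁
    rw [this]
    exact ⟨hz₁, hw₁⟩
  refine ⟨p₀, hp₀, fun r => ?_, fun i r => ?_⟩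
  · exact (tendsto_iff_ultrafilter _ _ _).2 fun U hU => (hall U hU).1 r
  · exact (tendsto_iff_ultrafilter _ _ _).2 fun U hU => (hall U hU).2 i r

end IsRun

end

end ProjSplit

end

theorem theorem4p1 {m : ℕ} {H : Fin (m + 1) → Type*}
    [∀ i, NormedAddCommGroup (H i)] [∀ i, InnerProductSpace ℝ (H i)]
    [∀ i, CompleteSpace (H i)]
    (P : ProjSplit.Problem H)
    (hG : P.G (Fin.last m) = ContinuousLinearMap.id ℝ (H (Fin.last m)))
    (hA : ∀ i, ProjSplit.IsMaximalMonotone (P.A i))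
    (hB : ∀ i, ProjSplit.IsMonotoneMap (P.B i) ∧ LipschitzWith (P.lipB i) (P.B i))
    (hC : ∀ i, 0 < P.β i ∧ ProjSplit.IsCocoercive (P.β i) (P.C i))
    (hD : ∀ i, ProjSplit.IsMonotoneMap (P.D i) ∧ ContDiff ℝ 1 (P.D i) ∧
      ∀ x y, ‖fderiv ℝ (P.D i) x - fderiv ℝ (P.D i) y‖ ≤ (P.lipD i : ℝ) * ‖x - y‖)
    (hsol : ∃ z : H (Fin.last m), 0 ∈ P.compositeOp z)
    (hID : (∀ i ∈ P.ID, 0 < P.lipD i) ∧ ∀ i ∉ P.ID, P.lipD i = 0 ∧ ∀ x, P.D i x = 0)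
    (q : ProjSplit.Params) (hq : q.Admissible)
    (s : ProjSplit.Iterates H) (hs : ProjSplit.IsRun P q s)
    (hρ : ∀ i ∉ P.ID, ∃ ρlo ρhi : ℝ, 0 < ρlo ∧
      ENNReal.ofReal ρhi < ((4 * P.β i)⁻¹ + (P.lipB i : ℝ≥0∞))⁻¹ ∧
      ∀ k, s.w k i ∉ P.T i (P.G i (s.z k)) → ρlo ≤ s.ρ k i ∧ s.ρ k i ≤ ρhi) :
    ∃ pbar ∈ P.extendedSolutionSet,
      ProjSplit.GammaWeakTendsto q.γ s.point pbar ∧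
      ProjSplit.WeakTendsto s.z pbar.1 ∧
      (∀ i, ProjSplit.WeakTendsto (fun k => s.w k i) (P.extendDual pbar.2 i)) ∧
      (∀ i, P.extendDual pbar.2 i ∈ P.T i (P.G i pbar.1)) ∧
      0 ∈ P.compositeOp pbar.1 ∧
      (∀ i, ProjSplit.WeakTendsto (fun k => s.x k i) (P.G i pbar.1)) ∧
      (∀ i, ProjSplit.WeakTendsto (fun k => s.y k i) (P.extendDual pbar.2 i)) := by
  have hP : P.IsRegular :=
    ⟨hG, hA, fun i => (hB i).1, fun i => (hB i).2, fun i => (hC i).1, fun i => (hC i).2,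
      fun i => (hD i).1, fun i => (hD i).2.1, fun i => (hD i).2.2, fun i hi => (hID.2 i hi).2⟩
  obtain ⟨z, hz⟩ := hsol
  obtain ⟨p, hp⟩ := P.exists_mem_extendedSolutionSet hG hz
  obtain ⟨p₀, hp₀, hz₀, hw₀⟩ := hs.exists_innerTendsto hP hq hρ hp
  have hw := hs.innerTendsto_w hw₀
  have hxy := hs.tendsto_sub_zero hP hq hρ hp
  exact ⟨p₀, hp₀, ProjSplit.tendsto_gammaInner (p := s.point) hz₀ hw₀,
    ProjSplit.weakTendsto_of_forall_inner hz₀,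
    fun i => ProjSplit.weakTendsto_of_forall_inner (hw i), hp₀,
    P.mem_compositeOp_of_mem hG hp₀,
    fun i => ProjSplit.weakTendsto_of_forall_inner
      ((hz₀.map (P.G i)).of_sub_tendsto_zero (hxy i).1),
    fun i => ProjSplit.weakTendsto_of_forall_inner ((hw i).of_sub_tendsto_zero (hxy i).2)⟩
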